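/- Let $G=(V,E)$ be a finite graph (parallel edges and loops are permitted), let $R$ be a finite multiset of vertices of $G$ (each $r\in R$ is a slider attached to the vertex that it names), and let $d:R\to\mathbb{P}^1(\mathbb{R})$ assign to each slider $r$ a direction $d_r$. For $v\in V$ let $R_v$ be the multiset of $r\in R$ attached to $v$; for $F\subseteq E$ let $V(F)$ be the set of vertices incident to $F$, let $R_F$ be the multiset of $r\in R$ attached to vertices of $V(F)$, and let $c(R_F)$ be the number of distinct directions among $d_r$, $r\in R_F$. A joint configuration is an injective map $p:V\to\mathbb{R}^2$. An infinitesimal motion of the bar-joint-slider framework $(G,R;p,d)$ is a map $m:V\to\mathbb{R}^2$ with $\langle p(u)-p(v),m(u)-m(v)\rangle=0$ for every edge $uv\in E$ and $\langle m(v),d_r^{\perp}\rangle=0$ for every $v\in V$ and $r\in R_v$, where $d_r^{\perp}$ is a unit vector orthogonal to the direction $d_r$. The framework is infinitesimally rigid if its only infinitesimal motion is $m=0$, and minimally infinitesimally rigid if it is infinitesimally rigid and ceases to be so whenever any single bar (edge) or any single slider is removed. Theorem. There is a joint configuration $p$ such that $(G,R;p,d)$ is minimally infinitesimally rigid if and only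 if all of the following hold: (i) for each $v\in V$, $|R_v|\le 2$ and the sliders in $R_v$ have pairwise distinct directions; (ii) $|F|+|R_F|\le 2|V(F)|-2+\min\{2,c(R_F)\}$ for every non-empty $F\subseteq E$; (iii) $|F|\le 2|V(F)|-3$ for every non-empty $F\subseteq E$; (iv) $|E|+|R|=2|V|$. -/

import Mathlib

/-- The Euclidean plane. -/
abbrev Plane : Type := EuclideanSpace ℝ (Fin 2)

/-- The real projective line: the lines through the origin of the plane, that is, the
directions of sliders. -/
abbrev Direction : Type := Projectivization ℝ Plane

/-- A 2-dimensional bar-joint-slider framework with joints `V`, bars `E` and sliders `R`.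
The graph is given by the end-vertices of its edges, and the multiset of vertices to which sliders
are attached is the family `root`. A joint-configuration is injective. -/
structure BarJointSliderFramework (V E R : Type*) where
  /-- the two end-joints of a bar -/
  ends : E → Sym2 V
  /-- the joint to which a slider is attached -/
  root : R → V
  /-- the direction of a slider -/
  dir : R → Direction
  /-- the position of a joint -/
  pos : V → Plane
  pos_injective : Function.Injective pos

namespace BarJointSliderFramework

variable {V E R : Type*}

/-- Infinitesimal motions: every bar constraint `⟨p(u) - p(v), m(u) - m(v)⟩ = 0` and every slider
constraint `⟨m(v), n⟩ = 0`, where `n` is the unit vector (unique up to sign) orthogonal to the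
direction of the slider, holds. -/
def IsInfinitesimalMotion (Φ : BarJointSliderFramework V E R) (m : V → Plane) : Prop :=
  (∀ (e : E) (u v : V), Φ.ends e = s(u, v) →
      inner ℝ (Φ.pos u - Φ.pos v) (m u - m v) = 0) ∧
  (∀ (r : R) (n : Plane), ‖n‖ = 1 → n ∈ (Φ.dir r).submoduleᗮ →
      inner ℝ (m (Φ.root r)) n = 0)

/-- There is no nonzero infinitesimal motion. -/
def IsInfinitesimallyRigid (Φ : BarJointSliderFramework V E R) : Prop :=
  ∀ m : V → Plane, Φ.IsInfinitesimalMotion m → m = 0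

/-- Remove one bar. -/
def deleteBar (Φ : BarJointSliderFramework V E R) (e : E) :
    BarJointSliderFramework V {e' : E // e' ≠ e} R where
  ends e' := Φ.ends e'
  root := Φ.root
  dir := Φ.dir
  pos := Φ.pos
  pos_injective := Φ.pos_injective

/-- Remove one slider. -/
def deleteSlider (Φ : BarJointSliderFramework V E R) (r : R) :
    BarJointSliderFramework V E {r' : R // r' ≠ r} where
  ends := Φ.ends
  root r' := Φ.root r'
  dir r' := Φ.dir r'
  pos := Φ.pos
  pos_injective := Φ.pos_injective

/-- Infinitesimally rigid, but no longer so after the removal of any bar or any slider. -/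
def IsMinimallyInfinitesimallyRigid (Φ : BarJointSliderFramework V E R) : Prop :=
  Φ.IsInfinitesimallyRigid ∧
  (∀ e : E, ¬ (Φ.deleteBar e).IsInfinitesimallyRigid) ∧
  (∀ r : R, ¬ (Φ.deleteSlider r).IsInfinitesimallyRigid)

end BarJointSliderFramework

/-- `V(F)`: the vertices incident to an edge in `F`. -/
def spannedVertices {V E : Type*} (ends : E → Sym2 V) (F : Set E) : Set V :=
  {v | ∃ e ∈ F, v ∈ ends e}

/-- `R_v`: the sliders attached to the vertex `v`. -/
def slidersAt {V R : Type*} (root : R → V) (v : V) : Set R :=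
  {r | root r = v}

/-- `R_F`: the sliders attached to the vertices of `V(F)`. -/
def slidersOn {V E R : Type*} (ends : E → Sym2 V) (root : R → V) (F : Set E) : Set R :=
  {r | root r ∈ spannedVertices ends F}

/-- The number of distinct directions among the sliders in `S`. -/
noncomputable def numDirections {R : Type*} (dir : R → Direction) (S : Set R) : ℕ :=
  (dir '' S).ncard

/-! Necessity is a rank count. Minimality supplies, for each bar or slider, a motion violating that
constraint alone (`exists_bar`, `exists_slider`), so the rows of the rigidity matrix are
independent. Rows supported on a vertex set W live on a space of dimension 2|W|, and they vanish on
every space of trivial motions of W; hence their number is at most 2|W| minus its dimension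
(`ncard_add_finrank_le`). All isometries of the plane contribute dimension 3 for bars alone, giving
(iii); translations along every slider direction present contribute 2 - min(2, c), giving (ii).

Sufficiency is a Henneberg-type induction on the number of vertices. The conditions are rewritten
for vertex sets as `SliderTight`. Averaging yields a vertex v carrying two or three constraints
(`exists_degree_le`, `two_le_degree`). With two, v is deleted. With three, v is deleted and one bar
or slider is added among its neighbours. If every candidate addition were blocked, each would be
blocked by a tight vertex set (`IsFull` or `IsLaman`); uncrossing these sets produces a set
containing v that violates a count (`delete_one_two`, `delete_two_one`, `delete_three_zero`).

Conversely, v is put back at a special position at which its constraints imply the added one and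
then fix v (`IsRigidOn.extend` and the `exists_rigid_*` lemmas). The required genericity comes from
perturbation, rigidity being an open condition on positions. Since |E| + |R| = 2|V| is the least
possible number of constraints, rigidity then implies minimality. -/

set_option linter.unusedSectionVars false

/-! ### Submodular counts and tight vertex sets -/

section Counting

variable {V α : Type*} [DecidableEq V] [DecidableEq α]

/-- The number of edges of `E` induced by `Y`. -/
def edgeCount (E : Finset (Sym2 V)) (Y : Finset V) : ℕ :=
  (E.filter (fun e => e.toFinset ⊆ Y)).card

/-- The number of sliders of `S` attached to `Y`. -/
def sliderCount (S : Finset (V × α)) (Y : Finset V) : ℕ :=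
  (S.filter (fun r => r.1 ∈ Y)).card

/-- The directions of the sliders of `S` attached to `Y`. -/
def sliderDirs (S : Finset (V × α)) (Y : Finset V) : Finset α :=
  (S.filter (fun r => r.1 ∈ Y)).image Prod.snd

/-- The rank of a set of directions of the plane. -/
def dirRank (A : Finset α) : ℕ := min 2 A.card

/-- The neighbours of `v` in `Y`. -/
def neighborsIn (E : Finset (Sym2 V)) (v : V) (Y : Finset V) : Finset V :=
  Y.filter (fun u => s(v, u) ∈ E)

/-- Only an inequality: an edge joining `Y \ Z` to `Z \ Y` is induced by the union and by neither
set. -/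
lemma edgeCount_union (E : Finset (Sym2 V)) (Y Z : Finset V) :
    edgeCount E Y + edgeCount E Z ≤ edgeCount E (Y ∪ Z) + edgeCount E (Y ∩ Z) := by
  unfold edgeCount
  rw [← Finset.card_union_add_card_inter]
  gcongr
  · intro e he
    simp only [Finset.mem_union, Finset.mem_filter, Finset.subset_iff, Sym2.mem_toFinset] at he ⊢
    rcases he with he | he
    · exact ⟨he.1, fun a ha => Or.inl (he.2 ha)⟩
    · exact ⟨he.1, fun a ha => Or.inr (he.2 ha)⟩
  · intro e he
    simp only [Finset.mem_inter, Finset.mem_filter, Finset.subset_iff, Sym2.mem_toFinset] at he ⊢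
    exact ⟨he.1.1, fun a ha => ⟨he.1.2 ha, he.2.2 ha⟩⟩

lemma sliderCount_union (S : Finset (V × α)) (Y Z : Finset V) :
    sliderCount S Y + sliderCount S Z = sliderCount S (Y ∪ Z) + sliderCount S (Y ∩ Z) := by
  unfold sliderCount
  rw [← Finset.card_union_add_card_inter]
  congr 2
  · ext r; simp only [Finset.mem_union, Finset.mem_filter]; tauto
  · ext r; simp only [Finset.mem_inter, Finset.mem_filter]; tauto

lemma sliderDirs_union (S : Finset (V × α)) (Y Z : Finset V) :
    sliderDirs S (Y ∪ Z) = sliderDirs S Y ∪ sliderDirs S Z := by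
  unfold sliderDirs
  rw [← Finset.image_union]
  congr 1
  ext r; simp only [Finset.mem_union, Finset.mem_filter]; tauto

lemma sliderDirs_mono (S : Finset (V × α)) {Y Z : Finset V} (h : Y ⊆ Z) :
    sliderDirs S Y ⊆ sliderDirs S Z := by
  rw [← Finset.union_eq_right.2 h, sliderDirs_union]
  exact Finset.subset_union_left

lemma dirRank_mono {A B : Finset α} (h : A ⊆ B) : dirRank A ≤ dirRank B := by
  have := Finset.card_le_card h
  unfold dirRank; omega

/-- Cardinality is modular and monotone, so truncating it at 2 leaves it submodular. -/
lemma dirRank_union (A B : Finset α) :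
    dirRank (A ∪ B) + dirRank (A ∩ B) ≤ dirRank A + dirRank B := by
  have h1 := Finset.card_union_add_card_inter A B
  have h2 : (A ∩ B).card ≤ A.card := Finset.card_le_card Finset.inter_subset_left
  have h3 : (A ∩ B).card ≤ B.card := Finset.card_le_card Finset.inter_subset_right
  unfold dirRank; omega

lemma dirRank_sliderDirs_union (S : Finset (V × α)) (Y Z : Finset V) :
    dirRank (sliderDirs S (Y ∪ Z)) + dirRank (sliderDirs S (Y ∩ Z)) ≤
      dirRank (sliderDirs S Y) + dirRank (sliderDirs S Z) := by
  have h1 := dirRank_union (sliderDirs S Y) (sliderDirs S Z)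
  have h2 : dirRank (sliderDirs S (Y ∩ Z)) ≤ dirRank (sliderDirs S Y ∩ sliderDirs S Z) :=
    dirRank_mono (Finset.subset_inter (sliderDirs_mono S Finset.inter_subset_left)
      (sliderDirs_mono S Finset.inter_subset_right))
  rw [sliderDirs_union]; omega

lemma dirRank_sliderDirs_le (S : Finset (V × α)) (Y : Finset V) :
    dirRank (sliderDirs S Y) ≤ sliderCount S Y :=
  (min_le_right _ _).trans Finset.card_image_le

/-- Enlarging a vertex set increases the rank by at most the number of new sliders. -/
lemma dirRank_add_sliderCount_le (S : Finset (V × α)) {Y Z : Finset V} (h : Y ⊆ Z) :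
    dirRank (sliderDirs S Z) + sliderCount S Y ≤ dirRank (sliderDirs S Y) + sliderCount S Z := by
  have h1 := dirRank_sliderDirs_union S Y (Z \ Y)
  have h2 := sliderCount_union S Y (Z \ Y)
  have h3 := dirRank_sliderDirs_le S (Z \ Y)
  rw [Finset.union_sdiff_of_subset h, Finset.inter_sdiff_self] at h1 h2
  have : sliderCount S ∅ = 0 := by simp [sliderCount]
  omega

lemma edgeCount_insert_ge (E : Finset (Sym2 V)) {v : V} {Y : Finset V} (hv : v ∉ Y) :
    edgeCount E Y + (neighborsIn E v Y).card ≤ edgeCount E (insert v Y) := by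
  unfold edgeCount neighborsIn
  rw [← Finset.card_image_of_injective (Y.filter (fun u => s(v, u) ∈ E))
    (f := fun u => s(v, u)) (fun a b h => Sym2.congr_right.1 h), ← Finset.card_union_of_disjoint]
  · apply Finset.card_le_card
    intro e he
    simp only [Finset.mem_union, Finset.mem_filter, Finset.mem_image, Finset.subset_iff, Sym2.mem_toFinset] at he ⊢
    rcases he with he | ⟨u, hu, rfl⟩
    · exact ⟨he.1, fun a ha => Finset.mem_insert_of_mem (he.2 ha)⟩
    · refine ⟨hu.2, fun a ha => ?_⟩
      rcases Sym2.mem_iff.1 ha with rfl | rfl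
      · exact Finset.mem_insert_self _ _
      · exact Finset.mem_insert_of_mem hu.1
  · rw [Finset.disjoint_left]
    intro e he he'
    simp only [Finset.mem_filter, Finset.mem_image, Finset.subset_iff, Sym2.mem_toFinset] at he he'
    obtain ⟨u, -, rfl⟩ := he'
    exact hv (he.2 (Sym2.mem_mk_left _ _))

lemma sliderCount_insert (S : Finset (V × α)) {v : V} {Y : Finset V} (hv : v ∉ Y) :
    sliderCount S (insert v Y) = sliderCount S Y + sliderCount S {v} := by
  have h := sliderCount_union S Y {v}
  rw [Finset.inter_singleton_of_notMem hv, Finset.union_singleton] at h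
  have : sliderCount S ∅ = 0 := by simp [sliderCount]
  omega

lemma sliderDirs_insert (S : Finset (V × α)) (v : V) (Y : Finset V) :
    sliderDirs S (insert v Y) = sliderDirs S Y ∪ sliderDirs S {v} := by
  rw [← sliderDirs_union, Finset.union_singleton]

/-- The counting conditions of a minimally rigid bar-joint-slider framework, in terms of
vertex sets. -/
structure SliderTight (X : Finset V) (E : Finset (Sym2 V)) (S : Finset (V × α)) : Prop where
  edge_mem : ∀ e ∈ E, ∀ a ∈ e, a ∈ X
  slider_mem : ∀ r ∈ S, r.1 ∈ X
  count_le : ∀ Y ⊆ X, Y.Nonempty →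
    edgeCount E Y + sliderCount S Y + 2 ≤ 2 * Y.card + dirRank (sliderDirs S Y)
  laman : ∀ Y ⊆ X, 2 ≤ Y.card → edgeCount E Y + 3 ≤ 2 * Y.card
  card_eq : E.card + S.card = 2 * X.card

/-- Vertex sets to which no edge can be added because of the slider count. -/
def IsFull (E : Finset (Sym2 V)) (S : Finset (V × α)) (Y : Finset V) : Prop :=
  2 * Y.card + dirRank (sliderDirs S Y) ≤ edgeCount E Y + sliderCount S Y + 2

/-- Vertex sets to which no edge can be added because of the Laman count. -/
def IsLaman (E : Finset (Sym2 V)) (Y : Finset V) : Prop :=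
  2 ≤ Y.card ∧ 2 * Y.card ≤ edgeCount E Y + 3

namespace SliderTight

variable {X : Finset V} {E : Finset (Sym2 V)} {S : Finset (V × α)}

/-- Standard uncrossing: the bound is submodular and the count supermodular, and the nonempty
intersection obeys `count_le`, so the union has no slack left. -/
lemma full_union_full (h : SliderTight X E S) {Y Z : Finset V} (hY : Y ⊆ X)
    (fY : IsFull E S Y) (fZ : IsFull E S Z) (hne : (Y ∩ Z).Nonempty) : IsFull E S (Y ∪ Z) := by
  have h1 := h.count_le (Y ∩ Z) (Finset.inter_subset_left.trans hY) hne
  have h2 := edgeCount_union E Y Z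
  have h3 := sliderCount_union S Y Z
  have h4 := dirRank_sliderDirs_union S Y Z
  have h5 := Finset.card_union_add_card_inter Y Z
  unfold IsFull at *; omega

/-- The Laman count of the intersection shows that `Z` adds at least two edges per new vertex, and
by `dirRank_add_sliderCount_le` the rank grows no faster than the number of sliders. So enlarging
`Y` creates no slack. -/
lemma full_union_laman (h : SliderTight X E S) {Y Z : Finset V} (hY : Y ⊆ X)
    (fY : IsFull E S Y) (fZ : IsLaman E Z) (hne : 2 ≤ (Y ∩ Z).card) : IsFull E S (Y ∪ Z) := by
  have h1 := h.laman (Y ∩ Z) (Finset.inter_subset_left.trans hY) hne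
  have h2 := edgeCount_union E Y Z
  have h4 := dirRank_add_sliderCount_le S (Finset.subset_union_left : Y ⊆ Y ∪ Z)
  have h5 := Finset.card_union_add_card_inter Y Z
  unfold IsFull IsLaman at *; omega

lemma laman_union_laman (h : SliderTight X E S) {Y Z : Finset V} (hY : Y ⊆ X)
    (fY : IsLaman E Y) (fZ : IsLaman E Z) (hne : 2 ≤ (Y ∩ Z).card) : IsLaman E (Y ∪ Z) := by
  have h1 := h.laman (Y ∩ Z) (Finset.inter_subset_left.trans hY) hne
  have h2 := edgeCount_union E Y Z
  have h5 := Finset.card_union_add_card_inter Y Z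
  have h6 : (Y ∩ Z).card ≤ Z.card := Finset.card_le_card Finset.inter_subset_right
  have h7 : (Y ∩ Z).card ≤ Y.card := Finset.card_le_card Finset.inter_subset_left
  unfold IsLaman at *; omega

/-- When the directions at `v` do not raise the rank, adding `v` raises the bound by exactly 2. This
limits the constraints that `v` may place on a full set, and is the source of the contradictions in
the uncrossing arguments. -/
lemma full_insert (h : SliderTight X E S) {Y : Finset V} {v : V} (hY : Y ⊆ X) (hv : v ∈ X)
    (hvY : v ∉ Y) (fY : IsFull E S Y)
    (hd : dirRank (sliderDirs S Y ∪ sliderDirs S {v}) = dirRank (sliderDirs S Y)) :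
    (neighborsIn E v Y).card + sliderCount S {v} ≤ 2 := by
  have h1 := h.count_le (insert v Y) (Finset.insert_subset hv hY) (Finset.insert_nonempty _ _)
  have h2 := edgeCount_insert_ge E hvY
  rw [sliderCount_insert S hvY, sliderDirs_insert, Finset.card_insert_of_notMem hvY, hd] at h1
  unfold IsFull at *; omega

lemma laman_insert (h : SliderTight X E S) {Y : Finset V} {v : V} (hY : Y ⊆ X) (hv : v ∈ X)
    (hvY : v ∉ Y) (fY : IsLaman E Y) : (neighborsIn E v Y).card ≤ 2 := by
  have h2 := edgeCount_insert_ge E hvY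
  have h1 := h.laman (insert v Y) (Finset.insert_subset hv hY) (by
    rw [Finset.card_insert_of_notMem hvY]; have := fY.1; omega)
  rw [Finset.card_insert_of_notMem hvY] at h1
  unfold IsLaman at *; omega

end SliderTight

end Counting

/-! ### Vertices of low degree and their removal -/

section Reduction

variable {V α : Type*} [DecidableEq V] [DecidableEq α]

/-- The edges of `E` that are not incident to `v`. -/
def edgesAvoiding (E : Finset (Sym2 V)) (v : V) : Finset (Sym2 V) :=
  E.filter (fun e => v ∉ e)

/-- The sliders of `S` that are not attached to `v`. -/
def slidersAvoiding (S : Finset (V × α)) (v : V) : Finset (V × α) :=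
  S.filter (fun r => r.1 ≠ v)

lemma edgeCount_empty (E : Finset (Sym2 V)) : edgeCount E ∅ = 0 := by
  unfold edgeCount
  rw [Finset.card_eq_zero, Finset.filter_eq_empty_iff]
  intro e _ h
  induction e with | _ a b
  exact absurd (h (Sym2.mem_toFinset.2 (Sym2.mem_mk_left a b))) (Finset.notMem_empty _)

lemma edgeCount_edgesAvoiding (E : Finset (Sym2 V)) {v : V} {Y : Finset V} (hv : v ∉ Y) :
    edgeCount (edgesAvoiding E v) Y = edgeCount E Y := by
  unfold edgeCount edgesAvoiding
  congr 1
  ext e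
  simp only [Finset.mem_filter]
  exact ⟨fun h => ⟨h.1.1, h.2⟩, fun h => ⟨⟨h.1, fun hve => hv (h.2 (Sym2.mem_toFinset.2 hve))⟩, h.2⟩⟩

lemma filter_slidersAvoiding (S : Finset (V × α)) {v : V} {Y : Finset V} (hv : v ∉ Y) :
    (slidersAvoiding S v).filter (fun r => r.1 ∈ Y) = S.filter (fun r => r.1 ∈ Y) := by
  unfold slidersAvoiding
  ext r
  simp only [Finset.mem_filter]
  exact ⟨fun h => ⟨h.1.1, h.2⟩, fun h => ⟨⟨h.1, fun hr => hv (hr ▸ h.2)⟩, h.2⟩⟩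

lemma sliderCount_slidersAvoiding (S : Finset (V × α)) {v : V} {Y : Finset V} (hv : v ∉ Y) :
    sliderCount (slidersAvoiding S v) Y = sliderCount S Y := by
  unfold sliderCount; rw [filter_slidersAvoiding S hv]

lemma sliderDirs_slidersAvoiding (S : Finset (V × α)) {v : V} {Y : Finset V} (hv : v ∉ Y) :
    sliderDirs (slidersAvoiding S v) Y = sliderDirs S Y := by
  unfold sliderDirs; rw [filter_slidersAvoiding S hv]

lemma edgeCount_insert_edge (E : Finset (Sym2 V)) {u w : V} (Y : Finset V) :
    edgeCount (insert s(u, w) E) Y ≤ edgeCount E Y + if u ∈ Y ∧ w ∈ Y then 1 else 0 := by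
  unfold edgeCount
  rw [Finset.filter_insert]
  have key : s(u, w).toFinset ⊆ Y ↔ u ∈ Y ∧ w ∈ Y := by
    simp [Finset.subset_iff]
  by_cases h : u ∈ Y ∧ w ∈ Y
  · rw [if_pos (key.2 h), if_pos h]; exact Finset.card_insert_le _ _
  · rw [if_neg (fun hh => h (key.1 hh)), if_neg h]; simp

lemma sliderCount_insert_slider (S : Finset (V × α)) (u : V) (d : α) (Y : Finset V) :
    sliderCount (insert (u, d) S) Y ≤ sliderCount S Y + if u ∈ Y then 1 else 0 := by
  unfold sliderCount
  rw [Finset.filter_insert]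
  split_ifs
  · exact Finset.card_insert_le _ _
  · simp

lemma sliderDirs_insert_slider (S : Finset (V × α)) (u : V) (d : α) (Y : Finset V) :
    sliderDirs (insert (u, d) S) Y = if u ∈ Y then insert d (sliderDirs S Y) else sliderDirs S Y := by
  unfold sliderDirs
  rw [Finset.filter_insert]
  split_ifs
  · rw [Finset.image_insert]
  · rfl

/-- Induced edge sets of vertex sets that pairwise meet in at most one vertex are disjoint. -/
lemma edgeCount_union_three {E : Finset (Sym2 V)} (hE : ∀ a, s(a, a) ∉ E) {A B C : Finset V}
    (hAB : (A ∩ B).card ≤ 1) (hAC : (A ∩ C).card ≤ 1) (hBC : (B ∩ C).card ≤ 1) :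
    edgeCount E A + edgeCount E B + edgeCount E C ≤ edgeCount E (A ∪ B ∪ C) := by
  have key : ∀ {A B : Finset V}, (A ∩ B).card ≤ 1 →
      Disjoint (E.filter (fun e => e.toFinset ⊆ A)) (E.filter (fun e => e.toFinset ⊆ B)) := by
    intro A B h
    rw [Finset.disjoint_left]
    intro e he he'
    simp only [Finset.mem_filter] at he he'
    induction e with | _ a b
    have ha : a ∈ s(a, b).toFinset := Sym2.mem_toFinset.2 (Sym2.mem_mk_left _ _)
    have hb : b ∈ s(a, b).toFinset := Sym2.mem_toFinset.2 (Sym2.mem_mk_right _ _)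
    have := Finset.card_le_one.1 h a (Finset.mem_inter.2 ⟨he.2 ha, he'.2 ha⟩) b
      (Finset.mem_inter.2 ⟨he.2 hb, he'.2 hb⟩)
    subst this
    exact hE _ he.1
  unfold edgeCount
  rw [← Finset.card_union_of_disjoint (key hAB), ← Finset.card_union_of_disjoint
    (Finset.disjoint_union_left.2 ⟨key hAC, key hBC⟩)]
  apply Finset.card_le_card
  intro e he
  simp only [Finset.mem_union, Finset.mem_filter, Finset.subset_iff] at he ⊢
  rcases he with (he | he) | he
  · exact ⟨he.1, fun a ha => Or.inl (Or.inl (he.2 ha))⟩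
  · exact ⟨he.1, fun a ha => Or.inl (Or.inr (he.2 ha))⟩
  · exact ⟨he.1, fun a ha => Or.inr (he.2 ha)⟩

lemma card_slidersAvoiding (S : Finset (V × α)) (v : V) :
    (slidersAvoiding S v).card + sliderCount S {v} = S.card := by
  unfold slidersAvoiding sliderCount
  rw [add_comm, ← Finset.card_filter_add_card_filter_not (s := S) (fun r => r.1 ∈ ({v} : Finset V))]
  simp

namespace SliderTight

variable {X : Finset V} {E : Finset (Sym2 V)} {S : Finset (V × α)}

lemma sliderCount_singleton_le (h : SliderTight X E S) {v : V} (hv : v ∈ X) :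
    edgeCount E {v} + sliderCount S {v} ≤ dirRank (sliderDirs S {v}) := by
  have := h.count_le {v} (Finset.singleton_subset_iff.2 hv) (Finset.singleton_nonempty v)
  rw [Finset.card_singleton] at this
  omega

lemma no_loop (h : SliderTight X E S) (v : V) : s(v, v) ∉ E := by
  intro hE
  have hv := h.edge_mem _ hE v (Sym2.mem_mk_left _ _)
  have h1 := h.sliderCount_singleton_le hv
  have h2 := dirRank_sliderDirs_le S {v}
  have h3 : 0 < edgeCount E {v} := by
    unfold edgeCount
    refine Finset.card_pos.2 ⟨s(v, v), Finset.mem_filter.2 ⟨hE, ?_⟩⟩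
    simp [Finset.subset_iff]
  omega

lemma card_incident (h : SliderTight X E S) (v : V) :
    (E.filter (fun e => v ∈ e)).card = (neighborsIn E v X).card := by
  unfold neighborsIn
  rw [← Finset.card_image_of_injective (X.filter (fun u => s(v, u) ∈ E))
    (f := fun u => s(v, u)) (fun a b h => Sym2.congr_right.1 h)]
  congr 1
  ext e
  simp only [Finset.mem_filter, Finset.mem_image]
  constructor
  · rintro ⟨he, u, rfl⟩
    exact ⟨u, ⟨h.edge_mem _ he u (Sym2.mem_mk_right _ _), he⟩, rfl⟩
  · rintro ⟨u, hu, rfl⟩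
    exact ⟨hu.2, Sym2.mem_mk_left _ _⟩

lemma card_edgesAvoiding (h : SliderTight X E S) (v : V) :
    (edgesAvoiding E v).card + (neighborsIn E v X).card = E.card := by
  rw [← h.card_incident v, add_comm]
  exact Finset.card_filter_add_card_filter_not _

lemma exists_degree_le (h : SliderTight X E S) (hX : X.Nonempty) :
    ∃ v ∈ X, (neighborsIn E v X).card + sliderCount S {v} ≤ 3 := by
  by_contra! hcon
  have h1 : ∑ v ∈ X, (neighborsIn E v X).card = 2 * E.card := by
    simp_rw [← h.card_incident]
    have := Finset.sum_card_bipartiteAbove_eq_sum_card_bipartiteBelow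
      (s := X) (t := E) (fun v e => v ∈ e)
    unfold Finset.bipartiteAbove Finset.bipartiteBelow at this
    rw [this, Finset.sum_const_nat (m := 2), mul_comm]
    intro e he
    have hd : ¬ e.IsDiag := by
      induction e with | _ a b
      intro hab
      rw [Sym2.mk_isDiag_iff] at hab
      subst hab
      exact h.no_loop _ he
    rw [← Sym2.card_toFinset_of_not_isDiag e hd]
    congr 1
    ext a
    simp only [Finset.mem_filter, Sym2.mem_toFinset]
    exact ⟨fun x => x.2, fun x => ⟨h.edge_mem e he a x, x⟩⟩
  have h2 : ∑ v ∈ X, sliderCount S {v} = S.card := by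
    rw [Finset.card_eq_sum_card_fiberwise (f := Prod.fst) (t := X) (fun r hr => h.slider_mem r hr)]
    simp [sliderCount]
  -- If every vertex carried four constraints, then 4|X| ≤ 2|E| + |S| = 4|X| - |S|, so there would
  -- be no sliders; but `count_le` on all of `X`, together with `card_eq`, forces at least two.
  have h3 : ∑ v ∈ X, 4 ≤ ∑ v ∈ X, ((neighborsIn E v X).card + sliderCount S {v}) :=
    Finset.sum_le_sum (fun v hv => hcon v hv)
  rw [Finset.sum_add_distrib, h1, h2, Finset.sum_const, smul_eq_mul] at h3
  have h4 := h.card_eq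
  have h5 := h.count_le X subset_rfl hX
  have h6 : edgeCount E X = E.card := by
    unfold edgeCount
    rw [Finset.filter_true_of_mem]
    intro e he a ha
    exact h.edge_mem e he a (Sym2.mem_toFinset.1 ha)
  have h7 : dirRank (sliderDirs S X) ≤ S.card :=
    (dirRank_sliderDirs_le S X).trans (Finset.card_filter_le _ _)
  have h8 : sliderCount S X = S.card := by
    unfold sliderCount
    rw [Finset.filter_true_of_mem h.slider_mem]
  have := hX.card_pos
  omega

/-- The other vertices can absorb at most 2(|X| - 1) of the 2|X| constraints. -/
lemma two_le_degree (h : SliderTight X E S) {v : V} (hv : v ∈ X) :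
    2 ≤ (neighborsIn E v X).card + sliderCount S {v} := by
  have h1 := h.card_edgesAvoiding v
  have h2 := card_slidersAvoiding S v
  have h3 := h.card_eq
  have h4 := Finset.card_erase_add_one hv
  have hvX : v ∉ X.erase v := Finset.notMem_erase v X
  have h5 : edgeCount E (X.erase v) = (edgesAvoiding E v).card := by
    unfold edgeCount edgesAvoiding
    congr 1
    ext e
    simp only [Finset.mem_filter, Finset.subset_iff, Sym2.mem_toFinset]
    exact ⟨fun x => ⟨x.1, fun hve => hvX (x.2 hve)⟩, fun x => ⟨x.1, fun a ha =>
      Finset.mem_erase.2 ⟨fun hh => x.2 (hh ▸ ha), h.edge_mem e x.1 a ha⟩⟩⟩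
  have h6 : sliderCount S (X.erase v) = (slidersAvoiding S v).card := by
    unfold sliderCount slidersAvoiding
    congr 1
    ext r
    simp only [Finset.mem_filter, Finset.mem_erase]
    exact ⟨fun x => ⟨x.1, x.2.1⟩, fun x => ⟨x.1, x.2, h.slider_mem r x.1⟩⟩
  have h8 := dirRank_sliderDirs_le S (X.erase v)
  have h9 : dirRank (sliderDirs S (X.erase v)) ≤ 2 := min_le_left _ _
  rcases (X.erase v).eq_empty_or_nonempty with he | hne
  · rw [he, edgeCount_empty] at h5
    rw [he] at h6 h4
    have : sliderCount S ∅ = 0 := by simp [sliderCount]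
    simp at h4
    omega
  · have h7 := h.count_le _ (Finset.erase_subset v X) hne
    omega

lemma sliderCount_le_two (h : SliderTight X E S) {v : V} (hv : v ∈ X) :
    sliderCount S {v} ≤ 2 := by
  have h1 := h.sliderCount_singleton_le hv
  have h2 : dirRank (sliderDirs S {v}) ≤ 2 := min_le_left _ _
  omega

lemma delete (h : SliderTight X E S) {v : V} (hv : v ∈ X)
    (hdeg : (neighborsIn E v X).card + sliderCount S {v} = 2) :
    SliderTight (X.erase v) (edgesAvoiding E v) (slidersAvoiding S v) where
  edge_mem e he a ha := Finset.mem_erase.2 ⟨fun hh => (Finset.mem_filter.1 he).2 (hh ▸ ha),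
    h.edge_mem e (Finset.mem_filter.1 he).1 a ha⟩
  slider_mem r hr := Finset.mem_erase.2 ⟨(Finset.mem_filter.1 hr).2,
    h.slider_mem r (Finset.mem_filter.1 hr).1⟩
  count_le Y hY hne := by
    have hvY : v ∉ Y := fun hh => Finset.notMem_erase v X (hY hh)
    rw [edgeCount_edgesAvoiding E hvY, sliderCount_slidersAvoiding S hvY,
      sliderDirs_slidersAvoiding S hvY]
    exact h.count_le Y (hY.trans (Finset.erase_subset _ _)) hne
  laman Y hY hne := by
    have hvY : v ∉ Y := fun hh => Finset.notMem_erase v X (hY hh)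
    rw [edgeCount_edgesAvoiding E hvY]
    exact h.laman Y (hY.trans (Finset.erase_subset _ _)) hne
  card_eq := by
    have h1 := h.card_edgesAvoiding v
    have h2 := card_slidersAvoiding S v
    have h3 := h.card_eq
    have h4 := Finset.card_erase_add_one hv
    omega

/-- A new edge increases the counts by one only on sets containing both ends; `hfree` provides the
slack of one on exactly those sets. -/
lemma delete_insert_edge (h : SliderTight X E S) {v u w : V} (hv : v ∈ X)
    (hdeg : (neighborsIn E v X).card + sliderCount S {v} = 3)
    (hu : u ∈ X.erase v) (hw : w ∈ X.erase v) (huw : u ≠ w)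
    (hfree : ∀ Z ⊆ X.erase v, u ∈ Z → w ∈ Z → ¬ IsFull E S Z ∧ ¬ IsLaman E Z) :
    SliderTight (X.erase v) (insert s(u, w) (edgesAvoiding E v)) (slidersAvoiding S v) where
  edge_mem e he a ha := by
    rcases Finset.mem_insert.1 he with rfl | he
    · rcases Sym2.mem_iff.1 ha with rfl | rfl
      exacts [hu, hw]
    · exact Finset.mem_erase.2 ⟨fun hh => (Finset.mem_filter.1 he).2 (hh ▸ ha),
        h.edge_mem e (Finset.mem_filter.1 he).1 a ha⟩
  slider_mem r hr := Finset.mem_erase.2 ⟨(Finset.mem_filter.1 hr).2,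
    h.slider_mem r (Finset.mem_filter.1 hr).1⟩
  count_le Y hY hne := by
    have hvY : v ∉ Y := fun hh => Finset.notMem_erase v X (hY hh)
    have h0 := edgeCount_insert_edge (edgesAvoiding E v) (u := u) (w := w) Y
    have h1 := h.count_le Y (hY.trans (Finset.erase_subset _ _)) hne
    rw [edgeCount_edgesAvoiding E hvY] at h0
    rw [sliderCount_slidersAvoiding S hvY, sliderDirs_slidersAvoiding S hvY]
    split_ifs at h0 with hh
    · have := (hfree Y hY hh.1 hh.2).1
      unfold IsFull at this; omega
    · omega
  laman Y hY hne := by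
    have hvY : v ∉ Y := fun hh => Finset.notMem_erase v X (hY hh)
    have h0 := edgeCount_insert_edge (edgesAvoiding E v) (u := u) (w := w) Y
    have h1 := h.laman Y (hY.trans (Finset.erase_subset _ _)) hne
    rw [edgeCount_edgesAvoiding E hvY] at h0
    split_ifs at h0 with hh
    · have := (hfree Y hY hh.1 hh.2).2
      unfold IsLaman at this; omega
    · omega
  card_eq := by
    have h1 := h.card_edgesAvoiding v
    have h2 := card_slidersAvoiding S v
    have h3 := h.card_eq
    have h4 := Finset.card_erase_add_one hv
    rw [Finset.card_insert_of_notMem]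
    · omega
    -- An edge already present would make `{u, w}` itself a Laman-tight set, so the added edge is
    -- new.
    · intro hE
      refine (hfree {u, w} (Finset.insert_subset hu (Finset.singleton_subset_iff.2 hw))
        (by simp) (by simp)).2 ?_
      have hc : ({u, w} : Finset V).card = 2 := Finset.card_pair huw
      have : 0 < edgeCount E {u, w} := Finset.card_pos.2 ⟨s(u, w), Finset.mem_filter.2
        ⟨(Finset.mem_filter.1 hE).1, by simp [Finset.subset_iff]⟩⟩
      unfold IsLaman; omega

lemma delete_insert_slider (h : SliderTight X E S) {v u : V} {d : α} (hv : v ∈ X)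
    (hdeg : (neighborsIn E v X).card + sliderCount S {v} = 3) (hu : u ∈ X.erase v)
    (hfree : ∀ Z ⊆ X.erase v, u ∈ Z → IsFull E S Z →
      dirRank (insert d (sliderDirs S Z)) ≠ dirRank (sliderDirs S Z)) :
    SliderTight (X.erase v) (edgesAvoiding E v) (insert (u, d) (slidersAvoiding S v)) where
  edge_mem e he a ha := Finset.mem_erase.2 ⟨fun hh => (Finset.mem_filter.1 he).2 (hh ▸ ha),
    h.edge_mem e (Finset.mem_filter.1 he).1 a ha⟩
  slider_mem r hr := by
    rcases Finset.mem_insert.1 hr with rfl | hr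
    · exact hu
    · exact Finset.mem_erase.2 ⟨(Finset.mem_filter.1 hr).2,
        h.slider_mem r (Finset.mem_filter.1 hr).1⟩
  count_le Y hY hne := by
    have hvY : v ∉ Y := fun hh => Finset.notMem_erase v X (hY hh)
    have h0 := sliderCount_insert_slider (slidersAvoiding S v) u d Y
    have h1 := h.count_le Y (hY.trans (Finset.erase_subset _ _)) hne
    have h2 : dirRank (sliderDirs S Y) ≤ dirRank (insert d (sliderDirs S Y)) :=
      dirRank_mono (Finset.subset_insert _ _)
    rw [sliderCount_slidersAvoiding S hvY] at h0
    rw [edgeCount_edgesAvoiding E hvY, sliderDirs_insert_slider, sliderDirs_slidersAvoiding S hvY]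
    split_ifs at h0 ⊢ with hh
    · have := hfree Y hY hh
      unfold IsFull at this; omega
    · omega
  laman Y hY hne := by
    have hvY : v ∉ Y := fun hh => Finset.notMem_erase v X (hY hh)
    rw [edgeCount_edgesAvoiding E hvY]
    exact h.laman Y (hY.trans (Finset.erase_subset _ _)) hne
  card_eq := by
    have h1 := h.card_edgesAvoiding v
    have h2 := card_slidersAvoiding S v
    have h3 := h.card_eq
    have h4 := Finset.card_erase_add_one hv
    rw [Finset.card_insert_of_notMem]
    · omega
    -- If the slider were already present, `{u}` would be a blocking set: every singleton in `X` is
    -- full or has spare rank only when sliders are missing, and here `dirRank` is at most the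
    -- slider count.
    · intro hS
      have hS' : (u, d) ∈ S := (Finset.mem_filter.1 hS).1
      have huX := Finset.mem_of_mem_erase hu
      refine hfree {u} (Finset.singleton_subset_iff.2 hu) (by simp) ?_ ?_
      · have := dirRank_sliderDirs_le S {u}
        unfold IsFull
        rw [Finset.card_singleton]
        omega
      · rw [Finset.insert_eq_of_mem]
        exact Finset.mem_image.2 ⟨(u, d), Finset.mem_filter.2 ⟨hS', by simp⟩, rfl⟩

/-- A vertex with one edge and two sliders: transfer a slider of a new direction to the
neighbour. -/
lemma delete_one_two (h : SliderTight X E S) {v u : V} {d : α} (hv : v ∈ X)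
    (hN : neighborsIn E v X = {u}) (hs : sliderCount S {v} = 2) (hd : d ∉ sliderDirs S X) :
    SliderTight (X.erase v) (edgesAvoiding E v) (insert (u, d) (slidersAvoiding S v)) := by
  have hu : u ∈ neighborsIn E v X := by simp [hN]
  have hu' := Finset.mem_filter.1 hu
  have huv : u ≠ v := by rintro rfl; exact h.no_loop _ hu'.2
  refine h.delete_insert_slider hv (by simp [hN, hs]) (Finset.mem_erase.2 ⟨huv, hu'.1⟩) ?_
  intro Z hZ huZ hF heq
  have hZX := hZ.trans (Finset.erase_subset v X)
  have hd' : d ∉ sliderDirs S Z := fun hh => hd (sliderDirs_mono S hZX hh)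
  have hvZ : v ∉ Z := fun hh => Finset.notMem_erase v X (hZ hh)
  have h1 : dirRank (sliderDirs S Z) ≤ dirRank (sliderDirs S Z ∪ sliderDirs S {v}) :=
    dirRank_mono Finset.subset_union_left
  -- A direction new to `Z` fails to raise its rank only when that rank is already 2, so the sliders
  -- at `v` cannot raise it either. Then `v` has two sliders and an edge to the full set `Z`, one
  -- constraint too many.
  have h2 := h.full_insert hZX hv hvZ hF (by
    unfold dirRank at heq h1 ⊢
    rw [Finset.card_insert_of_notMem hd'] at heq
    omega)
  have : 0 < (neighborsIn E v Z).card := Finset.card_pos.2 ⟨u, Finset.mem_filter.2 ⟨huZ, hu'.2⟩⟩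
  omega

end SliderTight

end Reduction

/-! ### Uncrossing the sets that block a reduction -/

section Uncrossing

variable {V α : Type*} [DecidableEq V] [DecidableEq α]

/-- The right-hand side expresses that `d` lies in the span of `A`: any two distinct directions
already span the plane. -/
lemma dirRank_insert_eq_iff {A : Finset α} {d : α} :
    dirRank (insert d A) = dirRank A ↔ d ∈ A ∨ 2 ≤ A.card := by
  unfold dirRank
  by_cases hd : d ∈ A
  · simp [hd]
  · rw [Finset.card_insert_of_notMem hd]
    simp only [hd, false_or]
    omega

/-- Two sets of directions whose spans share the direction `d`. -/
lemma dirRank_union_add_one_le {A B : Finset α} {d : α}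
    (hA : dirRank (insert d A) = dirRank A) (hB : dirRank (insert d B) = dirRank B) :
    dirRank (A ∪ B) + 1 ≤ dirRank A + dirRank B := by
  rw [dirRank_insert_eq_iff] at hA hB
  have h1 := Finset.card_union_add_card_inter A B
  have hA0 : d ∈ A → 0 < A.card := fun h => Finset.card_pos.2 ⟨d, h⟩
  have hB0 : d ∈ B → 0 < B.card := fun h => Finset.card_pos.2 ⟨d, h⟩
  have hAB : d ∈ A → d ∈ B → 0 < (A ∩ B).card :=
    fun h h' => Finset.card_pos.2 ⟨d, Finset.mem_inter.2 ⟨h, h'⟩⟩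
  unfold dirRank
  rcases hA with hA | hA <;> rcases hB with hB | hB
  · have := hAB hA hB; have := hA0 hA; have := hB0 hB; omega
  · have := hA0 hA; omega
  · have := hB0 hB; omega
  · omega

namespace SliderTight

variable {X : Finset V} {E : Finset (Sym2 V)} {S : Finset (V × α)}

/-- A vertex with two edges and one slider: either transfer the slider to one of the neighbours,
or join the neighbours by an edge. -/
lemma delete_two_one (h : SliderTight X E S) {v u w : V} {d : α} (hv : v ∈ X) (huw : u ≠ w)
    (hN : neighborsIn E v X = {u, w}) (hs : sliderCount S {v} = 1) (hd : (v, d) ∈ S) :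
    SliderTight (X.erase v) (edgesAvoiding E v) (insert (u, d) (slidersAvoiding S v)) ∨
    SliderTight (X.erase v) (edgesAvoiding E v) (insert (w, d) (slidersAvoiding S v)) ∨
    SliderTight (X.erase v) (insert s(u, w) (edgesAvoiding E v)) (slidersAvoiding S v) := by
  have hu := Finset.mem_filter.1 (show u ∈ neighborsIn E v X by simp [hN])
  have hw := Finset.mem_filter.1 (show w ∈ neighborsIn E v X by simp [hN])
  have huv : u ≠ v := by rintro rfl; exact h.no_loop _ hu.2
  have hwv : w ≠ v := by rintro rfl; exact h.no_loop _ hw.2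
  have huX := Finset.mem_erase.2 ⟨huv, hu.1⟩
  have hwX := Finset.mem_erase.2 ⟨hwv, hw.1⟩
  have hdeg : (neighborsIn E v X).card + sliderCount S {v} = 3 := by
    rw [hN, hs, Finset.card_pair huw]
  have hdirs : sliderDirs S {v} = {d} := by
    have h1 : d ∈ sliderDirs S {v} :=
      Finset.mem_image.2 ⟨(v, d), Finset.mem_filter.2 ⟨hd, by simp⟩, rfl⟩
    refine (Finset.eq_of_subset_of_card_le (Finset.singleton_subset_iff.2 h1) ?_).symm
    rw [Finset.card_singleton, ← hs]
    exact Finset.card_image_le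
  by_contra! hcon
  obtain ⟨hA, hB, hC⟩ := hcon
  replace hA := mt (h.delete_insert_slider hv hdeg huX) hA
  replace hB := mt (h.delete_insert_slider hv hdeg hwX) hB
  replace hC := mt (h.delete_insert_edge hv hdeg huX hwX huw) hC
  push Not at hA hB
  obtain ⟨A, hAX', huA, hAF, hAd⟩ := hA
  obtain ⟨B, hBX', hwB, hBF, hBd⟩ := hB
  have hC' : ∃ C ⊆ X.erase v, u ∈ C ∧ w ∈ C ∧ (IsFull E S C ∨ IsLaman E C) := by
    by_contra! hh
    exact hC fun Z hZ hu hw => hh Z hZ hu hw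
  obtain ⟨C, hCX', huC, hwC, hCF⟩ := hC'
  have hAX := hAX'.trans (Finset.erase_subset v X)
  have hBX := hBX'.trans (Finset.erase_subset v X)
  have hCX := hCX'.trans (Finset.erase_subset v X)
  have hvA : v ∉ A := fun hh => Finset.notMem_erase v X (hAX' hh)
  have hvB : v ∉ B := fun hh => Finset.notMem_erase v X (hBX' hh)
  have hvC : v ∉ C := fun hh => Finset.notMem_erase v X (hCX' hh)
  have hnb : ∀ Z, u ∈ Z → w ∈ Z → 2 ≤ (neighborsIn E v Z).card := fun Z hu' hw' => by
    rw [← Finset.card_pair huw]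
    exact Finset.card_le_card (Finset.insert_subset (Finset.mem_filter.2 ⟨hu', hu.2⟩)
      (Finset.singleton_subset_iff.2 (Finset.mem_filter.2 ⟨hw', hw.2⟩)))
  have closed : ∀ Z, dirRank (insert d (sliderDirs S A)) = dirRank (sliderDirs S A) → A ⊆ Z →
      dirRank (sliderDirs S Z ∪ sliderDirs S {v}) = dirRank (sliderDirs S Z) := fun Z hd hYZ => by
    rw [hdirs, Finset.union_singleton]
    rw [dirRank_insert_eq_iff] at hd ⊢
    exact hd.imp (fun x => sliderDirs_mono S hYZ x)
      (fun x => x.trans (Finset.card_le_card (sliderDirs_mono S hYZ)))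
  -- Both neighbours lie in such a `Z` and `d` lies in the span of its directions, so `v` would put
  -- three constraints on it without raising the rank.
  have no_full : ∀ Z ⊆ X, v ∉ Z → A ⊆ Z → w ∈ Z → ¬ IsFull E S Z := fun Z hZX hvZ hAZ hwZ hF => by
    have h1 := h.full_insert hZX hv hvZ hF (closed Z hAd hAZ)
    have h2 := hnb Z (hAZ huA) hwZ
    omega
  have hAB : A ∩ B = ∅ := by
    by_contra hne
    exact no_full (A ∪ B) (Finset.union_subset hAX hBX) (by simp [hvA, hvB])
      Finset.subset_union_left (Finset.mem_union_right _ hwB)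
      (h.full_union_full hAX hAF hBF (Finset.nonempty_iff_ne_empty.2 hne))
  have no_full' : ¬ IsFull E S (A ∪ C) :=
    no_full (A ∪ C) (Finset.union_subset hAX hCX) (by simp [hvA, hvC])
      Finset.subset_union_left (Finset.mem_union_right _ hwC)
  have hCL : IsLaman E C := hCF.resolve_left fun hF =>
    no_full' (h.full_union_full hAX hAF hF ⟨u, Finset.mem_inter.2 ⟨huA, huC⟩⟩)
  have hAC : (A ∩ C).card ≤ 1 := by
    by_contra! hne
    exact no_full' (h.full_union_laman hAX hAF hCL hne)
  have hBC : (B ∩ C).card ≤ 1 := by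
    by_contra! hne
    have hF := h.full_union_laman hBX hBF hCL hne
    have hF' := h.full_union_full hAX hAF hF ⟨u, Finset.mem_inter.2
      ⟨huA, Finset.mem_union_right _ huC⟩⟩
    refine no_full _ ?_ ?_ Finset.subset_union_left ?_ hF'
    · exact Finset.union_subset hAX (Finset.union_subset hBX hCX)
    · simp [hvA, hvB, hvC]
    · simp [hwC]
  have hU : v ∉ A ∪ B ∪ C := by simp [hvA, hvB, hvC]
  -- The sets now overlap too little to share edges. Counting on their union with `v` exceeds the
  -- bound by exactly one: that unit comes from `e8`, where the spans of the directions of `A` and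
  -- `B` share `d`.
  have e1 := edgeCount_union_three h.no_loop (by simp [hAB]) hAC hBC
  have e2 := edgeCount_insert_ge E hU
  have e3 := hnb (A ∪ B ∪ C) (by simp [huA]) (by simp [hwB])
  have e4 := h.count_le (insert v (A ∪ B ∪ C)) (Finset.insert_subset hv
    (Finset.union_subset (Finset.union_subset hAX hBX) hCX)) (Finset.insert_nonempty _ _)
  rw [sliderCount_insert S hU, sliderDirs_insert, Finset.card_insert_of_notMem hU,
    closed _ hAd (Finset.subset_union_left.trans Finset.subset_union_left)] at e4
  have e5 := dirRank_add_sliderCount_le S (Finset.subset_union_left : A ∪ B ⊆ A ∪ B ∪ C)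
  have e6 := sliderCount_union S A B
  have e7 : sliderCount S (A ∩ B) = 0 := by simp [hAB, sliderCount]
  have e8 := dirRank_union_add_one_le hAd hBd
  rw [← sliderDirs_union] at e8
  have c1 := Finset.card_union_add_card_inter (A ∪ B) C
  have c2 := Finset.card_union_add_card_inter A B
  have c3 : 2 ≤ ((A ∪ B) ∩ C).card := by
    rw [← Finset.card_pair huw]
    exact Finset.card_le_card (Finset.insert_subset (by simp [huA, huC])
      (Finset.singleton_subset_iff.2 (by simp [hwB, hwC])))
  unfold IsFull at hAF hBF
  unfold IsLaman at hCL
  omega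

/-- A vertex with three edges: two of its neighbours may be joined by an edge. -/
lemma delete_three_zero (h : SliderTight X E S) {v x y z : V} (hv : v ∈ X) (hxy : x ≠ y)
    (hxz : x ≠ z) (hyz : y ≠ z) (hN : neighborsIn E v X = {x, y, z})
    (hs : sliderCount S {v} = 0) :
    SliderTight (X.erase v) (insert s(x, y) (edgesAvoiding E v)) (slidersAvoiding S v) ∨
    SliderTight (X.erase v) (insert s(x, z) (edgesAvoiding E v)) (slidersAvoiding S v) ∨
    SliderTight (X.erase v) (insert s(y, z) (edgesAvoiding E v)) (slidersAvoiding S v) := by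
  have hc3 : ({x, y, z} : Finset V).card = 3 := by
    rw [Finset.card_insert_of_notMem (by simp [hxy, hxz]), Finset.card_pair hyz]
  have hx := Finset.mem_filter.1 (show x ∈ neighborsIn E v X by simp [hN])
  have hy := Finset.mem_filter.1 (show y ∈ neighborsIn E v X by simp [hN])
  have hz := Finset.mem_filter.1 (show z ∈ neighborsIn E v X by simp [hN])
  have hxv : x ≠ v := by rintro rfl; exact h.no_loop _ hx.2
  have hyv : y ≠ v := by rintro rfl; exact h.no_loop _ hy.2
  have hzv : z ≠ v := by rintro rfl; exact h.no_loop _ hz.2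
  have hxX := Finset.mem_erase.2 ⟨hxv, hx.1⟩
  have hyX := Finset.mem_erase.2 ⟨hyv, hy.1⟩
  have hzX := Finset.mem_erase.2 ⟨hzv, hz.1⟩
  have hdeg : (neighborsIn E v X).card + sliderCount S {v} = 3 := by rw [hN, hs, hc3]
  have block : ∀ {a b : V}, a ∈ X.erase v → b ∈ X.erase v → a ≠ b →
      ¬ SliderTight (X.erase v) (insert s(a, b) (edgesAvoiding E v)) (slidersAvoiding S v) →
      ∃ Z ⊆ X, v ∉ Z ∧ a ∈ Z ∧ b ∈ Z ∧ (IsFull E S Z ∨ IsLaman E Z) := by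
    intro a b ha hb hab hT
    by_contra! hh
    exact hT (h.delete_insert_edge hv hdeg ha hb hab fun Z hZ hu hw =>
      hh Z (hZ.trans (Finset.erase_subset v X)) (fun hh => Finset.notMem_erase v X (hZ hh)) hu hw)
  by_contra! hcon
  obtain ⟨A, hAX, hvA, hxA, hyA, hA⟩ := block hxX hyX hxy hcon.1
  obtain ⟨B, hBX, hvB, hxB, hzB, hB⟩ := block hxX hzX hxz hcon.2.1
  obtain ⟨C, hCX, hvC, hyC, hzC, hC⟩ := block hyX hzX hyz hcon.2.2
  have hdirs : sliderDirs S {v} = ∅ := by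
    rw [← Finset.card_eq_zero, ← Nat.le_zero, ← hs]
    exact Finset.card_image_le
  have hnb : ∀ Z, x ∈ Z → y ∈ Z → z ∈ Z → 3 ≤ (neighborsIn E v Z).card := fun Z hx' hy' hz' => by
    rw [← hc3]
    refine Finset.card_le_card (Finset.insert_subset (Finset.mem_filter.2 ⟨hx', hx.2⟩)
      (Finset.insert_subset (Finset.mem_filter.2 ⟨hy', hy.2⟩)
        (Finset.singleton_subset_iff.2 (Finset.mem_filter.2 ⟨hz', hz.2⟩))))
  have no_block : ∀ Z ⊆ X, v ∉ Z → x ∈ Z → y ∈ Z → z ∈ Z → ¬ (IsFull E S Z ∨ IsLaman E Z) := by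
    rintro Z hZX hvZ hx' hy' hz' (hF | hL)
    · have h1 := h.full_insert hZX hv hvZ hF (by rw [hdirs, Finset.union_empty])
      have h2 := hnb Z hx' hy' hz'
      omega
    · have h1 := h.laman_insert hZX hv hvZ hL
      have h2 := hnb Z hx' hy' hz'
      omega
  -- Two blocking sets covering the three neighbours cannot be uncrossed, as their union would block
  -- all three at once. So they share at most one vertex and are not both full.
  have meet : ∀ {Y Z : Finset V}, Y ⊆ X → Z ⊆ X → v ∉ Y → v ∉ Z → x ∈ Y ∪ Z → y ∈ Y ∪ Z →
      z ∈ Y ∪ Z → (Y ∩ Z).Nonempty → (IsFull E S Y ∨ IsLaman E Y) → (IsFull E S Z ∨ IsLaman E Z) →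
      (Y ∩ Z).card ≤ 1 ∧ (IsLaman E Y ∨ IsLaman E Z) := by
    intro Y Z hYX hZX hvY hvZ hx' hy' hz' hne hY hZ
    have no := no_block (Y ∪ Z) (Finset.union_subset hYX hZX) (by simp [hvY, hvZ]) hx' hy' hz'
    rcases hY with hY | hY <;> rcases hZ with hZ | hZ
    · exact absurd (Or.inl (h.full_union_full hYX hY hZ hne)) no
    · refine ⟨?_, Or.inr hZ⟩
      by_contra! hc
      exact no (Or.inl (h.full_union_laman hYX hY hZ hc))
    · refine ⟨?_, Or.inl hY⟩
      by_contra! hc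
      rw [Finset.inter_comm] at hc
      rw [Finset.union_comm] at no
      exact no (Or.inl (h.full_union_laman hZX hZ hY hc))
    · refine ⟨?_, Or.inl hY⟩
      by_contra! hc
      exact no (Or.inr (h.laman_union_laman hYX hY hZ hc))
  obtain ⟨hAB, lAB⟩ := meet hAX hBX hvA hvB (by simp [hxA]) (by simp [hyA]) (by simp [hzB])
    ⟨x, by simp [hxA, hxB]⟩ hA hB
  obtain ⟨hAC, lAC⟩ := meet hAX hCX hvA hvC (by simp [hxA]) (by simp [hyA]) (by simp [hzC])
    ⟨y, by simp [hyA, hyC]⟩ hA hC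
  obtain ⟨hBC, lBC⟩ := meet hBX hCX hvB hvC (by simp [hxB]) (by simp [hyC]) (by simp [hzC])
    ⟨z, by simp [hzB, hzC]⟩ hB hC
  have hU : v ∉ A ∪ B ∪ C := by simp [hvA, hvB, hvC]
  have hUX : insert v (A ∪ B ∪ C) ⊆ X :=
    Finset.insert_subset hv (Finset.union_subset (Finset.union_subset hAX hBX) hCX)
  have e1 := edgeCount_union_three h.no_loop hAB hAC hBC
  have e2 := edgeCount_insert_ge E hU
  have e3 := hnb (A ∪ B ∪ C) (by simp [hxA]) (by simp [hyA]) (by simp [hzB])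
  have e4 := h.count_le _ hUX (Finset.insert_nonempty _ _)
  have e5 := h.laman _ hUX (by
    rw [← Finset.card_pair hxy]
    exact Finset.card_le_card (Finset.insert_subset (by simp [hxA])
      (Finset.singleton_subset_iff.2 (by simp [hyA]))))
  rw [sliderCount_insert S hU, sliderDirs_insert, hdirs, Finset.union_empty,
    Finset.card_insert_of_notMem hU] at e4
  rw [Finset.card_insert_of_notMem hU] at e5
  have c1 := Finset.card_union_add_card_inter (A ∪ B) C
  have c2 := Finset.card_union_add_card_inter A B
  have c3 : 2 ≤ ((A ∪ B) ∩ C).card := by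
    rw [← Finset.card_pair hyz]
    exact Finset.card_le_card (Finset.insert_subset (by simp [hyA, hyC])
      (Finset.singleton_subset_iff.2 (by simp [hzB, hzC])))
  have c4 : 0 < (A ∩ B).card := Finset.card_pos.2 ⟨x, by simp [hxA, hxB]⟩
  have full : ∀ {Z}, Z ⊆ A ∪ B ∪ C → IsFull E S Z →
      2 * Z.card + dirRank (sliderDirs S (A ∪ B ∪ C)) ≤
        edgeCount E Z + sliderCount S (A ∪ B ∪ C) + 2 := fun hZ hF => by
    have := dirRank_add_sliderCount_le S hZ
    unfold IsFull at hF
    omega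
  -- At most one set is full. If all are Laman-tight, the Laman count of the union with `v` fails;
  -- if one is full, its slider count fails.
  have final : IsLaman E A ∧ IsLaman E B ∧ IsLaman E C ∨ IsFull E S A ∧ IsLaman E B ∧ IsLaman E C ∨
      IsLaman E A ∧ IsFull E S B ∧ IsLaman E C ∨ IsLaman E A ∧ IsLaman E B ∧ IsFull E S C := by
    clear * - lAB lAC lBC hA hB hC
    tauto
  clear lAB lAC lBC hA hB hC hAB hAC hBC block hcon
  rcases final with ⟨hA, hB, hC⟩ | ⟨hA, hB, hC⟩ | ⟨hA, hB, hC⟩ | ⟨hA, hB, hC⟩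
  · linarith [hA.2, hB.2, hC.2]
  · linarith [full (Finset.subset_union_left.trans Finset.subset_union_left) hA, hB.2, hC.2]
  · linarith [full (Finset.subset_union_right.trans Finset.subset_union_left) hB, hA.2, hC.2]
  · linarith [full Finset.subset_union_right hC, hA.2, hB.2]

end SliderTight

end Uncrossing

/-! ### Normals and directions in the plane -/

section PlaneGeometry

/-- Rotation of the plane by a right angle. -/
noncomputable def rot (x : Plane) : Plane := !₂[-x 1, x 0]

/-- The determinant of two vectors of the plane. -/
def wedge (x y : Plane) : ℝ := x 0 * y 1 - x 1 * y 0

@[simp] lemma rot_zero (x : Plane) : rot x 0 = -x 1 := rfl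

@[simp] lemma rot_one (x : Plane) : rot x 1 = x 0 := rfl

lemma inner_plane (x y : Plane) : inner ℝ x y = x 0 * y 0 + x 1 * y 1 := by
  simp [PiLp.inner_apply, Fin.sum_univ_two, mul_comm]

lemma plane_ext {x y : Plane} (h0 : x 0 = y 0) (h1 : x 1 = y 1) : x = y := by
  ext i; fin_cases i
  exacts [h0, h1]

lemma sq_add_sq_ne_zero {x : Plane} (hx : x ≠ 0) : x 0 ^ 2 + x 1 ^ 2 ≠ 0 := by
  intro h
  exact hx (plane_ext (by simp; nlinarith [sq_nonneg (x 0), sq_nonneg (x 1)])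
    (by simp; nlinarith [sq_nonneg (x 0), sq_nonneg (x 1)]))

lemma rot_ne_zero {x : Plane} (hx : x ≠ 0) : rot x ≠ 0 := by
  intro h
  have h0 := congrArg (fun y : Plane => y 0) h
  have h1 := congrArg (fun y : Plane => y 1) h
  simp at h0 h1
  exact hx (plane_ext (by simpa using h1) (by simpa using h0))

lemma wedge_rot_ne_zero {x : Plane} (hx : x ≠ 0) : wedge (rot x) x ≠ 0 := by
  intro h
  apply sq_add_sq_ne_zero hx
  simp only [wedge, rot_zero, rot_one] at h
  linarith

lemma eq_zero_of_inner_eq_zero {a b m : Plane} (h : wedge a b ≠ 0) (ha : inner ℝ a m = 0)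
    (hb : inner ℝ b m = 0) : m = 0 := by
  rw [inner_plane] at ha hb
  unfold wedge at h
  refine plane_ext (mul_left_cancel₀ h ?_) (mul_left_cancel₀ h ?_)
  · rw [PiLp.zero_apply]; linear_combination b 1 * ha - a 1 * hb
  · rw [PiLp.zero_apply]; linear_combination a 0 * hb - b 0 * ha

lemma exists_smul_of_wedge_eq_zero {x y : Plane} (hx : x ≠ 0) (h : wedge x y = 0) :
    ∃ a : ℝ, a • x = y := by
  have hs := sq_add_sq_ne_zero hx
  unfold wedge at h
  refine ⟨(x 0 * y 0 + x 1 * y 1) / (x 0 ^ 2 + x 1 ^ 2), plane_ext ?_ ?_⟩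
  · simp; field_simp; linear_combination x 1 * h
  · simp; field_simp; linear_combination -x 0 * h

/-- A normal vector of a direction. -/
noncomputable def dirNormal (d : Direction) : Plane := rot d.rep

lemma dirNormal_ne_zero (d : Direction) : dirNormal d ≠ 0 :=
  rot_ne_zero d.rep_nonzero

lemma wedge_dirNormal_ne_zero {d d' : Direction} (h : d ≠ d') :
    wedge (dirNormal d) (dirNormal d') ≠ 0 := by
  intro hw
  have hw' : wedge d'.rep d.rep = 0 := by
    simp only [wedge, dirNormal, rot_zero, rot_one] at hw ⊢
    linarith
  obtain ⟨a, ha⟩ := exists_smul_of_wedge_eq_zero d'.rep_nonzero hw'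
  apply h
  rw [← d.mk_rep, ← d'.mk_rep]
  exact (Projectivization.mk_eq_mk_iff' ℝ _ _ _ _).2 ⟨a, ha⟩

lemma mem_submodule_iff (d : Direction) (x : Plane) :
    x ∈ d.submodule ↔ inner ℝ x (dirNormal d) = 0 := by
  rw [Projectivization.submodule_eq, Submodule.mem_span_singleton, inner_plane]
  constructor
  · rintro ⟨a, rfl⟩
    simp [dirNormal]
    ring
  · intro h
    refine exists_smul_of_wedge_eq_zero d.rep_nonzero ?_
    simp only [wedge, dirNormal, rot_zero, rot_one] at h ⊢
    linarith

lemma forall_unit_normal_iff (d : Direction) (x : Plane) :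
    (∀ n : Plane, ‖n‖ = 1 → n ∈ d.submoduleᗮ → inner ℝ x n = 0) ↔
      inner ℝ x (dirNormal d) = 0 := by
  rw [← mem_submodule_iff]
  constructor
  · intro h
    rw [mem_submodule_iff]
    have hn := dirNormal_ne_zero d
    have := h ((‖dirNormal d‖⁻¹ : ℝ) • dirNormal d) (norm_smul_inv_norm hn) (by
      refine Submodule.smul_mem _ _ ((Submodule.mem_orthogonal _ _).2 fun u hu => ?_)
      exact (mem_submodule_iff d u).1 hu)
    rw [inner_smul_right] at this
    exact (mul_eq_zero.1 this).resolve_left (inv_ne_zero (norm_ne_zero_iff.2 hn))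
  · intro h n _ hn
    exact (Submodule.mem_orthogonal _ _).1 hn x h

/-- Supplies the fresh slider direction for the reduction at a vertex with one edge and two sliders.
The witnesses are the non-vertical lines, indexed by slope. -/
instance infinite_direction : Infinite Direction := by
  have hne : ∀ t : ℝ, (!₂[1, t] : Plane) ≠ 0 := fun t h => by
    have := congrArg (fun y : Plane => y 0) h
    simp at this
  refine Infinite.of_injective (fun t : ℝ => Projectivization.mk ℝ (!₂[1, t] : Plane) (hne t)) ?_
  intro s t hst
  obtain ⟨a, ha⟩ := (Projectivization.mk_eq_mk_iff' ℝ _ _ _ _).1 hst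
  have h0 := congrArg (fun y : Plane => y 0) ha
  have h1 := congrArg (fun y : Plane => y 1) ha
  simp at h0 h1
  rw [h0] at h1
  linarith

end PlaneGeometry

/-! ### Openness of rigidity and perturbation to general position -/

section Rigid

open Filter Topology

variable {V : Type*} [DecidableEq V]

/-- The bar and slider constraints for an infinitesimal motion. -/
def IsMotion (E : Finset (Sym2 V)) (S : Finset (V × Direction)) (p m : V → Plane) : Prop :=
  (∀ u w, s(u, w) ∈ E → inner ℝ (p u - p w) (m u - m w) = 0) ∧
  (∀ r ∈ S, inner ℝ (dirNormal r.2) (m r.1) = 0)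

/-- There is no nonzero infinitesimal motion supported on `X`. -/
def IsRigidOn (X : Finset V) (E : Finset (Sym2 V)) (S : Finset (V × Direction))
    (p : V → Plane) : Prop :=
  ∀ m, (∀ x ∉ X, m x = 0) → IsMotion E S p m → m = 0

/-- A flexible position admits a motion of norm 1. The pairs of a position and such a motion form a
closed set, and projecting along the compact unit sphere keeps it closed. -/
lemma isOpen_setOf_isRigidOn [Finite V] (X : Finset V) (E : Finset (Sym2 V))
    (S : Finset (V × Direction)) : IsOpen {p | IsRigidOn X E S p} := by
  have := Fintype.ofFinite V
  let C : Set ((V → Plane) × Metric.sphere (0 : V → Plane) 1) :=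
    {q | (∀ x ∉ X, q.2.1 x = 0) ∧ IsMotion E S q.1 q.2.1}
  have hm : ∀ x, Continuous fun q : (V → Plane) × Metric.sphere (0 : V → Plane) 1 => q.2.1 x :=
    fun x => (continuous_apply x).comp (continuous_subtype_val.comp continuous_snd)
  have hC : IsClosed C := by
    unfold C IsMotion
    simp only [Set.ofPred_and, Set.ofPred_forall]
    refine IsClosed.inter ?_ (IsClosed.inter ?_ ?_)
    · refine isClosed_iInter fun x => isClosed_iInter fun _ => isClosed_eq (hm x) continuous_const
    · refine isClosed_iInter fun u => isClosed_iInter fun w => isClosed_iInter fun _ =>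
        isClosed_eq (Continuous.inner (by fun_prop) ((hm u).sub (hm w))) continuous_const
    · exact isClosed_iInter fun r => isClosed_iInter fun _ =>
        isClosed_eq (continuous_const.inner (hm r.1)) continuous_const
  have hcl := isClosedMap_fst_of_compactSpace _ hC
  rw [← isOpen_compl_iff] at hcl
  convert hcl using 1
  ext p
  simp only [Set.mem_ofPred_eq, Set.mem_compl_iff, Set.mem_image, not_exists]
  constructor
  · rintro h ⟨q, m⟩ ⟨hq, rfl⟩
    have := h _ hq.1 hq.2
    have hm := m.2
    rw [this] at hm
    simp at hm
  · intro h m hX hm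
    by_contra hne
    refine h (p, ⟨(‖m‖⁻¹ : ℝ) • m, by simpa using norm_smul_inv_norm (𝕜 := ℝ) hne⟩)
      ⟨⟨fun x hx => by simp [hX x hx], fun u w hE => ?_, fun r hr => ?_⟩, rfl⟩
    · simp only [Pi.smul_apply]
      rw [← smul_sub, inner_smul_right, hm.1 u w hE, mul_zero]
    · simp only [Pi.smul_apply]
      rw [inner_smul_right, hm.2 r hr, mul_zero]

lemma eventually_quadratic_ne_zero {a b c : ℝ} (h : b ≠ 0 ∨ c ≠ 0) :
    ∀ᶠ t in 𝓝[≠] (0 : ℝ), a + b * t + c * t ^ 2 ≠ 0 := by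
  let P : Polynomial ℝ := Polynomial.C a + Polynomial.C b * Polynomial.X +
    Polynomial.C c * Polynomial.X ^ 2
  have hP : P ≠ 0 := by
    intro h0
    have h1 := congrArg (fun Q => Polynomial.coeff Q 1) h0
    have h2 := congrArg (fun Q => Polynomial.coeff Q 2) h0
    simp [P, Polynomial.coeff_C] at h1 h2
    tauto
  have hfin : (P.roots.toFinset : Set ℝ).Finite := Finset.finite_toSet _
  -- Since `a` is arbitrary, 0 may itself be a root; it is discarded, and the remaining finitely
  -- many roots stay away from 0.
  have : ((P.roots.toFinset : Set ℝ) \ {0})ᶜ ∈ 𝓝 (0 : ℝ) :=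
    (hfin.subset Set.sdiff_subset).isClosed.isOpen_compl.mem_nhds (by simp)
  filter_upwards [mem_nhdsWithin_of_mem_nhds this, self_mem_nhdsWithin] with t ht ht0 hz
  refine ht ⟨?_, ht0⟩
  rw [Finset.mem_coe, Multiset.mem_toFinset, Polynomial.mem_roots hP]
  simpa [P, Polynomial.IsRoot] using hz

/-- A rigid position may be perturbed in the direction `q`. -/
lemma IsRigidOn.eventually [Finite V] {X : Finset V} {E : Finset (Sym2 V)}
    {S : Finset (V × Direction)} {p : V → Plane} (h : IsRigidOn X E S p) (q : V → Plane) :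
    ∀ᶠ t in 𝓝[≠] (0 : ℝ), IsRigidOn X E S (p + t • q) := by
  have hc : Continuous fun t : ℝ => p + t • q := by fun_prop
  have := hc.continuousAt.preimage_mem_nhds (x := 0)
    ((isOpen_setOf_isRigidOn X E S).mem_nhds (by simpa using h))
  exact mem_nhdsWithin_of_mem_nhds this

lemma IsRigidOn.exists_injective [Finite V] {X : Finset V} {E : Finset (Sym2 V)}
    {S : Finset (V × Direction)} {p : V → Plane} (h : IsRigidOn X E S p) :
    ∃ p', IsRigidOn X E S p' ∧ Function.Injective p' := by
  obtain ⟨n, ⟨f⟩⟩ := Finite.exists_equiv_fin V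
  -- Joints drift horizontally at pairwise different speeds, so each pair coincides for at most one
  -- time.
  let q : V → Plane := fun v => !₂[((f v : ℕ) : ℝ), 0]
  have key : ∀ u w : V, ∀ᶠ t in 𝓝[≠] (0 : ℝ), u ≠ w → (p + t • q) u ≠ (p + t • q) w := by
    intro u w
    by_cases huw : u = w
    · simp [huw]
    have hb : ((f u : ℕ) : ℝ) - ((f w : ℕ) : ℝ) ≠ 0 := by
      rw [sub_ne_zero]
      simpa [Fin.val_inj] using huw
    filter_upwards [eventually_quadratic_ne_zero (a := p u 0 - p w 0) (c := 0) (Or.inl hb)]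
      with t ht _ heq
    apply ht
    have := congrArg (fun y : Plane => y 0) heq
    simp [q] at this
    linarith
  obtain ⟨t, ht, ht'⟩ := ((h.eventually q).and
    (eventually_all.2 fun u => eventually_all.2 fun w => key u w)).exists
  exact ⟨_, ht, fun u w huw => by_contra fun hne => ht' u w hne huw⟩

lemma IsRigidOn.exists_wedge_ne_zero [Finite V] {X : Finset V} {E : Finset (Sym2 V)}
    {S : Finset (V × Direction)} {p : V → Plane} (h : IsRigidOn X E S p) {u w : V} (huw : u ≠ w)
    {n : Plane} (hn : n ≠ 0) : ∃ p', IsRigidOn X E S p' ∧ wedge (p' w - p' u) n ≠ 0 := by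
  -- Only `w` moves, perpendicular to `n`; the wedge is affine in time with slope `wedge (rot n) n`.
  let q : V → Plane := Function.update 0 w (rot n)
  have hb := wedge_rot_ne_zero hn
  obtain ⟨t, ht, ht'⟩ := ((h.eventually q).and (eventually_quadratic_ne_zero
    (a := wedge (p w - p u) n) (c := 0) (Or.inl hb))).exists
  refine ⟨_, ht, fun h0 => ht' (Eq.trans ?_ h0)⟩
  simp [q, huw, wedge]
  ring

lemma IsRigidOn.exists_wedge_sub_ne_zero [Finite V] {X : Finset V} {E : Finset (Sym2 V)}
    {S : Finset (V × Direction)} {p : V → Plane} (h : IsRigidOn X E S p) {u w x : V}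
    (huw : u ≠ w) (hux : u ≠ x) (hwx : w ≠ x) :
    ∃ p', IsRigidOn X E S p' ∧ wedge (p' w - p' u) (p' x - p' u) ≠ 0 := by
  -- Moving `w` and `x` along the two axes makes the wedge a quadratic in time with leading
  -- coefficient 1.
  let q : V → Plane := Function.update (Function.update 0 w !₂[1, 0]) x !₂[0, 1]
  obtain ⟨t, ht, ht'⟩ := ((h.eventually q).and (eventually_quadratic_ne_zero
    (a := wedge (p w - p u) (p x - p u)) (b := (p x - p u) 1 + (p w - p u) 0) (c := 1)
    (Or.inr one_ne_zero))).exists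
  refine ⟨_, ht, fun h0 => ht' (Eq.trans ?_ h0)⟩
  simp [q, huw, hux, hwx, wedge]
  ring

end Rigid

/-! ### Reinserting a vertex -/

section Extension

variable {V : Type*} [DecidableEq V] [DecidableEq Direction] {X : Finset V} {E : Finset (Sym2 V)}
  {S : Finset (V × Direction)}

lemma IsMotion.insert_edge {p m : V → Plane} (h : IsMotion E S p m) {u w : V}
    (huw : inner ℝ (p u - p w) (m u - m w) = 0) : IsMotion (insert s(u, w) E) S p m := by
  refine ⟨fun a b hab => ?_, h.2⟩
  rcases Finset.mem_insert.1 hab with hab | hab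
  · rcases Sym2.eq_iff.1 hab with ⟨rfl, rfl⟩ | ⟨rfl, rfl⟩
    · exact huw
    · rwa [← neg_sub, ← neg_sub (m b), inner_neg_neg]
  · exact h.1 a b hab

lemma IsMotion.insert_slider {p m : V → Plane} (h : IsMotion E S p m) {u : V} {d : Direction}
    (hu : inner ℝ (dirNormal d) (m u) = 0) : IsMotion E (insert (u, d) S) p m := by
  refine ⟨h.1, fun r hr => ?_⟩
  rcases Finset.mem_insert.1 hr with rfl | hr
  · exact hu
  · exact h.2 r hr

lemma IsMotion.avoiding {p m : V → Plane} {v : V} {y : Plane}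
    (h : IsMotion E S (Function.update p v y) m) :
    IsMotion (edgesAvoiding E v) (slidersAvoiding S v) p m := by
  refine ⟨fun a b hab => ?_, fun r hr => h.2 r (Finset.mem_filter.1 hr).1⟩
  obtain ⟨hE, hv⟩ := Finset.mem_filter.1 hab
  have hva : a ≠ v := by rintro rfl; exact hv (Sym2.mem_mk_left _ _)
  have hvb : b ≠ v := by rintro rfl; exact hv (Sym2.mem_mk_right _ _)
  simpa [hva, hvb] using h.1 a b hE

lemma IsMotion.edge_at {p m : V → Plane} {v u : V} {y : Plane}
    (h : IsMotion E S (Function.update p v y) m) (hvu : s(v, u) ∈ E) (huv : u ≠ v) :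
    inner ℝ (y - p u) (m v - m u) = 0 := by
  simpa [huv] using h.1 v u hvu

lemma IsMotion.slider_at {p m : V → Plane} {v : V} {d : Direction} (h : IsMotion E S p m)
    (hvd : (v, d) ∈ S) : inner ℝ (dirNormal d) (m v) = 0 :=
  h.2 (v, d) hvd

/-- Rigidity is preserved by adding a vertex that is fixed as soon as all others are. -/
lemma IsRigidOn.extend {E' : Finset (Sym2 V)} {S' : Finset (V × Direction)} {p : V → Plane}
    {v : V} {y : Plane} (h : IsRigidOn (X.erase v) E' S' p) (hE' : ∀ e ∈ E', v ∉ e)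
    (hS' : ∀ r ∈ S', r.1 ≠ v)
    (hm : ∀ m, IsMotion E S (Function.update p v y) m → IsMotion E' S' p m) {a b : Plane}
    (hab : wedge a b ≠ 0)
    (hv : ∀ m, IsMotion E S (Function.update p v y) m → (∀ x ≠ v, m x = 0) →
      inner ℝ a (m v) = 0 ∧ inner ℝ b (m v) = 0) :
    IsRigidOn X E S (Function.update p v y) := by
  intro m hX hmot
  have hm' := hm m hmot
  -- The constraints in `E'` and `S'` do not involve `v`, so resetting the velocity there gives a
  -- motion supported on `X.erase v`.
  have h0 : Function.update m v 0 = 0 := by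
    refine h _ (fun x hx => ?_) ⟨fun u w huw => ?_, fun r hr => ?_⟩
    · by_cases hxv : x = v
      · simp [hxv]
      · rw [Function.update_of_ne hxv]
        exact hX x fun hh => hx (Finset.mem_erase.2 ⟨hxv, hh⟩)
    · have hne := hE' _ huw
      have hu : u ≠ v := by rintro rfl; exact hne (Sym2.mem_mk_left _ _)
      have hw : w ≠ v := by rintro rfl; exact hne (Sym2.mem_mk_right _ _)
      simpa [hu, hw] using hm'.1 u w huw
    · rw [Function.update_of_ne (hS' r hr)]
      exact hm'.2 r hr
  have h1 : ∀ x ≠ v, m x = 0 := fun x hx => by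
    simpa [hx] using congrFun h0 x
  funext x
  by_cases hx : x = v
  · subst hx
    exact eq_zero_of_inner_eq_zero hab (hv m hmot h1).1 (hv m hmot h1).2
  · exact h1 x hx

lemma edgesAvoiding_notMem {v : V} : ∀ e ∈ edgesAvoiding E v, v ∉ e :=
  fun _ he => (Finset.mem_filter.1 he).2

lemma slidersAvoiding_ne {v : V} : ∀ r ∈ slidersAvoiding S v, r.1 ≠ v :=
  fun _ hr => (Finset.mem_filter.1 hr).2

lemma insert_edgesAvoiding_notMem {v u w : V} (hu : u ≠ v) (hw : w ≠ v) :
    ∀ e ∈ insert s(u, w) (edgesAvoiding E v), v ∉ e := by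
  intro e he hv
  rcases Finset.mem_insert.1 he with rfl | he
  · rcases Sym2.mem_iff.1 hv with rfl | rfl
    exacts [hu rfl, hw rfl]
  · exact edgesAvoiding_notMem e he hv

lemma insert_slidersAvoiding_ne {v u : V} {d : Direction} (hu : u ≠ v) :
    ∀ r ∈ insert (u, d) (slidersAvoiding S v), r.1 ≠ v := by
  intro r hr
  rcases Finset.mem_insert.1 hr with rfl | hr
  exacts [hu, slidersAvoiding_ne r hr]

variable [Finite V]

/-- It suffices to place `v` off the line through the two neighbours, which must therefore be at
distinct points. -/
lemma exists_rigid_two_edges {p : V → Plane} {v u w : V}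
    (h : IsRigidOn (X.erase v) (edgesAvoiding E v) (slidersAvoiding S v) p)
    (hu : u ≠ v) (hw : w ≠ v) (huw : u ≠ w) (hvu : s(v, u) ∈ E) (hvw : s(v, w) ∈ E) :
    ∃ p, IsRigidOn X E S p := by
  obtain ⟨p, h, hp⟩ := h.exists_injective
  have hne : p w - p u ≠ 0 := sub_ne_zero.2 fun hh => huw (hp hh).symm
  refine ⟨_, h.extend (y := p u + rot (p w - p u)) edgesAvoiding_notMem slidersAvoiding_ne
    (fun m hm => hm.avoiding) (a := rot (p w - p u)) (b := rot (p w - p u) - (p w - p u)) ?_ ?_⟩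
  · have := wedge_rot_ne_zero hne
    intro h0
    apply this
    simp [wedge] at h0 ⊢
    linarith
  · intro m hm h0
    have h1 := hm.edge_at hvu hu
    have h2 := hm.edge_at hvw hw
    rw [h0 u hu, sub_zero, add_sub_cancel_left] at h1
    rw [h0 w hw, sub_zero] at h2
    refine ⟨h1, ?_⟩
    rw [← h2]
    congr 1
    abel

lemma exists_rigid_edge_slider {p : V → Plane} {v u : V} {d : Direction}
    (h : IsRigidOn (X.erase v) (edgesAvoiding E v) (slidersAvoiding S v) p)
    (hu : u ≠ v) (hvu : s(v, u) ∈ E) (hvd : (v, d) ∈ S) :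
    ∃ p, IsRigidOn X E S p := by
  refine ⟨_, h.extend (y := p u + rot (dirNormal d)) edgesAvoiding_notMem slidersAvoiding_ne
    (fun m hm => hm.avoiding) (a := rot (dirNormal d))
    (b := dirNormal d) (wedge_rot_ne_zero (dirNormal_ne_zero d)) ?_⟩
  intro m hm h0
  have h1 := hm.edge_at hvu hu
  rw [h0 u hu, sub_zero, add_sub_cancel_left] at h1
  exact ⟨h1, hm.slider_at hvd⟩

lemma exists_rigid_two_sliders {p : V → Plane} {v : V} {d d' : Direction}
    (h : IsRigidOn (X.erase v) (edgesAvoiding E v) (slidersAvoiding S v) p)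
    (hvd : (v, d) ∈ S) (hvd' : (v, d') ∈ S) (hd : d ≠ d') :
    ∃ p, IsRigidOn X E S p :=
  -- The two sliders fix `v` wherever it is placed; 0 is an arbitrary choice.
  ⟨_, h.extend (y := 0) edgesAvoiding_notMem slidersAvoiding_ne
    (fun _ hm => hm.avoiding) (a := dirNormal d) (b := dirNormal d')
    (wedge_dirNormal_ne_zero hd)
    fun _ hm _ => ⟨hm.slider_at hvd, hm.slider_at hvd'⟩⟩

/-- The sliders pin `v`, so the bar to `u` acts as a slider at `u` whose normal is the direction of
the bar. Placing `v` at `p u + dirNormal d₀` realises the added slider. -/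
lemma exists_rigid_edge_two_sliders {p : V → Plane} {v u : V} {d d' d₀ : Direction}
    (h : IsRigidOn (X.erase v) (edgesAvoiding E v) (insert (u, d₀) (slidersAvoiding S v)) p)
    (hu : u ≠ v) (hvu : s(v, u) ∈ E) (hvd : (v, d) ∈ S) (hvd' : (v, d') ∈ S) (hd : d ≠ d') :
    ∃ p, IsRigidOn X E S p := by
  refine ⟨_, h.extend (y := p u + dirNormal d₀) edgesAvoiding_notMem
    (insert_slidersAvoiding_ne hu) (fun m hm => hm.avoiding.insert_slider ?_)
    (a := dirNormal d) (b := dirNormal d') (wedge_dirNormal_ne_zero hd) fun _ hm _ => ⟨hm.slider_at hvd, hm.slider_at hvd'⟩⟩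
  have h0 := eq_zero_of_inner_eq_zero (wedge_dirNormal_ne_zero hd) (hm.slider_at hvd) (hm.slider_at hvd')
  have h1 := hm.edge_at hvu hu
  rwa [h0, zero_sub, inner_neg_right, neg_eq_zero, add_sub_cancel_left] at h1

/-- With the bar to `u` along the normal of `d`, it transmits the slider of `v` to `u`. The bar to
`w` then fixes `v`, provided that it is not parallel to that normal. -/
lemma exists_rigid_move_slider {p : V → Plane} {v u w : V} {d : Direction}
    (h : IsRigidOn (X.erase v) (edgesAvoiding E v) (insert (u, d) (slidersAvoiding S v)) p)
    (hu : u ≠ v) (hw : w ≠ v) (huw : u ≠ w) (hvu : s(v, u) ∈ E) (hvw : s(v, w) ∈ E)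
    (hvd : (v, d) ∈ S) : ∃ p, IsRigidOn X E S p := by
  obtain ⟨p, h, hp⟩ := h.exists_wedge_ne_zero huw.symm (dirNormal_ne_zero d)
  refine ⟨_, h.extend (y := p u + dirNormal d) edgesAvoiding_notMem
    (insert_slidersAvoiding_ne hu) (fun m hm => hm.avoiding.insert_slider ?_)
    (a := p u + dirNormal d - p w) (b := dirNormal d) ?_ fun m hm h0 => ⟨?_, hm.slider_at hvd⟩⟩
  · have h1 := hm.edge_at hvu hu
    rwa [add_sub_cancel_left, inner_sub_right, hm.slider_at hvd, zero_sub, neg_eq_zero] at h1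
  · intro h0
    apply hp
    simp [wedge] at h0 ⊢
    linarith
  · have h1 := hm.edge_at hvw hw
    rwa [h0 w hw, sub_zero] at h1

/-- With `v` on the line through `u` and `w`, its two bars are parallel, and subtracting their
constraints yields that of a bar between `u` and `w`. Thus `v` simulates the added edge. -/
lemma IsMotion.line_edge {p m : V → Plane} {v u w : V}
    (hm : IsMotion E S (Function.update p v (p w + (p w - p u))) m)
    (hu : u ≠ v) (hw : w ≠ v) (hvu : s(v, u) ∈ E) (hvw : s(v, w) ∈ E) :
    inner ℝ (p w - p u) (m v - m w) = 0 ∧ inner ℝ (p u - p w) (m u - m w) = 0 := by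
  have h1 := hm.edge_at hvu hu
  have h2 := hm.edge_at hvw hw
  rw [add_sub_cancel_left] at h2
  have h3 : p w + (p w - p u) - p u = (2 : ℝ) • (p w - p u) := by module
  rw [h3, real_inner_smul_left] at h1
  refine ⟨h2, ?_⟩
  have h4 : p u - p w = -(p w - p u) := by abel
  have h5 : m u - m w = (m v - m w) - (m v - m u) := by abel
  rw [h4, h5, inner_neg_left, inner_sub_right, h2]
  linarith

lemma exists_rigid_line_slider {p : V → Plane} {v u w : V} {d : Direction}
    (h : IsRigidOn (X.erase v) (insert s(u, w) (edgesAvoiding E v)) (slidersAvoiding S v) p)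
    (hu : u ≠ v) (hw : w ≠ v) (huw : u ≠ w) (hvu : s(v, u) ∈ E) (hvw : s(v, w) ∈ E)
    (hvd : (v, d) ∈ S) : ∃ p, IsRigidOn X E S p := by
  obtain ⟨p, h, hp⟩ := h.exists_wedge_ne_zero huw (dirNormal_ne_zero d)
  refine ⟨_, h.extend (y := p w + (p w - p u)) (insert_edgesAvoiding_notMem hu hw)
    slidersAvoiding_ne (fun m hm => hm.avoiding.insert_edge (hm.line_edge hu hw hvu hvw).2)
    (a := p w - p u) (b := dirNormal d) hp fun m hm h0 => ⟨?_, hm.slider_at hvd⟩⟩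
  have h1 := (hm.line_edge hu hw hvu hvw).1
  rwa [h0 w hw, sub_zero] at h1

lemma exists_rigid_line_edge {p : V → Plane} {v u w x : V}
    (h : IsRigidOn (X.erase v) (insert s(u, w) (edgesAvoiding E v)) (slidersAvoiding S v) p)
    (hu : u ≠ v) (hw : w ≠ v) (hx : x ≠ v) (huw : u ≠ w) (hux : u ≠ x) (hwx : w ≠ x)
    (hvu : s(v, u) ∈ E) (hvw : s(v, w) ∈ E) (hvx : s(v, x) ∈ E) : ∃ p, IsRigidOn X E S p := by
  obtain ⟨p, h, hp⟩ := h.exists_wedge_sub_ne_zero huw hux hwx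
  refine ⟨_, h.extend (y := p w + (p w - p u)) (insert_edgesAvoiding_notMem hu hw)
    slidersAvoiding_ne (fun m hm => hm.avoiding.insert_edge (hm.line_edge hu hw hvu hvw).2)
    (a := p w - p u) (b := p w + (p w - p u) - p x) ?_ fun m hm h0 => ⟨?_, ?_⟩⟩
  · intro h0
    apply hp
    simp [wedge] at h0 ⊢
    linarith
  · have h1 := (hm.line_edge hu hw hvu hvw).1
    rwa [h0 w hw, sub_zero] at h1
  · have h1 := hm.edge_at hvx hx
    rwa [h0 x hx, sub_zero] at h1

/-- The counting conditions suffice for the existence of a rigid position. -/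
theorem SliderTight.exists_isRigidOn (h : SliderTight X E S) :
    ∃ p, IsRigidOn X E S p := by
  induction hn : X.card generalizing X E S with
  | zero =>
    refine ⟨0, fun m hm _ => funext fun x => hm x ?_⟩
    rw [Finset.card_eq_zero.1 hn]
    exact Finset.notMem_empty x
  | succ n ih =>
    obtain ⟨v, hv, hdeg⟩ := h.exists_degree_le (Finset.card_pos.1 (by omega))
    have hdeg' := h.two_le_degree hv
    have hs2 := h.sliderCount_le_two hv
    have hc : (X.erase v).card = n := by rw [Finset.card_erase_of_mem hv]; omega
    have nb : ∀ u ∈ neighborsIn E v X, u ≠ v ∧ s(v, u) ∈ E := fun u hu => by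
      have := (Finset.mem_filter.1 hu).2
      exact ⟨by rintro rfl; exact h.no_loop _ this, this⟩
    have one : 1 ≤ sliderCount S {v} → ∃ d, (v, d) ∈ S := fun h1 => by
      obtain ⟨⟨w, d⟩, hr⟩ := Finset.card_pos.1 (show 0 < sliderCount S {v} by omega)
      obtain ⟨hr1, hr2⟩ := Finset.mem_filter.1 hr
      rw [Finset.mem_singleton] at hr2
      exact ⟨d, by rwa [← hr2]⟩
    have two : sliderCount S {v} = 2 → ∃ d d', (v, d) ∈ S ∧ (v, d') ∈ S ∧ d ≠ d' := fun h1 => by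
      obtain ⟨⟨w, d⟩, ⟨w', d'⟩, hne, hr⟩ := Finset.card_eq_two.1 h1
      have hd : (w, d) ∈ S.filter (fun r => r.1 ∈ ({v} : Finset V)) := by rw [hr]; simp
      have hd' : (w', d') ∈ S.filter (fun r => r.1 ∈ ({v} : Finset V)) := by rw [hr]; simp
      simp only [Finset.mem_filter, Finset.mem_singleton] at hd hd'
      obtain ⟨hd, rfl⟩ := hd
      obtain ⟨hd', rfl⟩ := hd'
      exact ⟨d, d', hd, hd', fun hh => hne (by rw [hh])⟩
    rcases Nat.lt_or_ge ((neighborsIn E v X).card + sliderCount S {v}) 3 with h3 | h3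
    · obtain ⟨p, hp⟩ := ih (h.delete hv (by omega)) hc
      have hs : sliderCount S {v} = 0 ∨ sliderCount S {v} = 1 ∨ sliderCount S {v} = 2 := by omega
      rcases hs with hs | hs | hs
      · obtain ⟨u, w, huw, hN⟩ := Finset.card_eq_two.1
          (show (neighborsIn E v X).card = 2 by omega)
        obtain ⟨hu, hvu⟩ := nb u (by simp [hN])
        obtain ⟨hw, hvw⟩ := nb w (by simp [hN])
        exact exists_rigid_two_edges hp hu hw huw hvu hvw
      · obtain ⟨u, hN⟩ := Finset.card_eq_one.1 (show (neighborsIn E v X).card = 1 by omega)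
        obtain ⟨hu, hvu⟩ := nb u (by simp [hN])
        obtain ⟨d, hd⟩ := one hs.ge
        exact exists_rigid_edge_slider hp hu hvu hd
      · obtain ⟨d, d', hd, hd', hne⟩ := two hs
        exact exists_rigid_two_sliders hp hd hd' hne
    · have hs : sliderCount S {v} = 0 ∨ sliderCount S {v} = 1 ∨ sliderCount S {v} = 2 := by omega
      rcases hs with hs | hs | hs
      · obtain ⟨x, y, z, hxy, hxz, hyz, hN⟩ := Finset.card_eq_three.1
          (show (neighborsIn E v X).card = 3 by omega)
        obtain ⟨hx, hvx⟩ := nb x (by simp [hN])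
        obtain ⟨hy, hvy⟩ := nb y (by simp [hN])
        obtain ⟨hz, hvz⟩ := nb z (by simp [hN])
        rcases h.delete_three_zero hv hxy hxz hyz hN hs with ht | ht | ht
        · obtain ⟨p, hp⟩ := ih ht hc
          exact exists_rigid_line_edge hp hx hy hz hxy hxz hyz hvx hvy hvz
        · obtain ⟨p, hp⟩ := ih ht hc
          exact exists_rigid_line_edge hp hx hz hy hxz hxy hyz.symm hvx hvz hvy
        · obtain ⟨p, hp⟩ := ih ht hc
          exact exists_rigid_line_edge hp hy hz hx hyz hxy.symm hxz.symm hvy hvz hvx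
      · obtain ⟨u, w, huw, hN⟩ := Finset.card_eq_two.1
          (show (neighborsIn E v X).card = 2 by omega)
        obtain ⟨hu, hvu⟩ := nb u (by simp [hN])
        obtain ⟨hw, hvw⟩ := nb w (by simp [hN])
        obtain ⟨d, hd⟩ := one hs.ge
        rcases h.delete_two_one hv huw hN hs hd with ht | ht | ht
        · obtain ⟨p, hp⟩ := ih ht hc
          exact exists_rigid_move_slider hp hu hw huw hvu hvw hd
        · obtain ⟨p, hp⟩ := ih ht hc
          exact exists_rigid_move_slider hp hw hu huw.symm hvw hvu hd
        · obtain ⟨p, hp⟩ := ih ht hc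
          exact exists_rigid_line_slider hp hu hw huw hvu hvw hd
      · obtain ⟨u, hN⟩ := Finset.card_eq_one.1 (show (neighborsIn E v X).card = 1 by omega)
        obtain ⟨hu, hvu⟩ := nb u (by simp [hN])
        obtain ⟨d, d', hd, hd', hne⟩ := two hs
        -- The added slider needs a direction used nowhere in the framework; the given directions
        -- need not suffice.
        obtain ⟨d₀, hd₀⟩ := Infinite.exists_notMem_finset (sliderDirs S X)
        obtain ⟨p, hp⟩ := ih (h.delete_one_two hv hN hs hd₀) hc
        exact exists_rigid_edge_two_sliders hp hu hvu hd hd' hne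

end Extension

/-! ### Independent rows and trivial motions: necessity -/

section Rows

variable {V E R : Type*}

/-- The row of the rigidity matrix given by a bar with end-vertices `z`. -/
noncomputable def barRow (p : V → Plane) (z : Sym2 V) : (V → Plane) →ₗ[ℝ] ℝ :=
  Sym2.lift ⟨fun u w =>
    { toFun := fun m => inner ℝ (p u - p w) (m u - m w)
      map_add' := fun m m' => by
        rw [← inner_add_right, Pi.add_apply, Pi.add_apply, add_sub_add_comm]
      map_smul' := fun c m => by
        rw [Pi.smul_apply, Pi.smul_apply, ← smul_sub, inner_smul_right, RingHom.id_apply,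
          smul_eq_mul] },
    fun u w => LinearMap.ext fun m => by
      change inner ℝ (p u - p w) (m u - m w) = inner ℝ (p w - p u) (m w - m u)
      rw [← neg_sub, ← neg_sub (m w), inner_neg_neg]⟩ z

lemma barRow_mk (p : V → Plane) (u w : V) (m : V → Plane) :
    barRow p s(u, w) m = inner ℝ (p u - p w) (m u - m w) := rfl

lemma barRow_congr (p : V → Plane) (z : Sym2 V) {m m' : V → Plane} (h : ∀ a ∈ z, m a = m' a) :
    barRow p z m = barRow p z m' := by
  induction z with | _ u w
  rw [barRow_mk, barRow_mk, h u (Sym2.mem_mk_left _ _), h w (Sym2.mem_mk_right _ _)]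

/-- The row of the rigidity matrix given by a slider at `v` of direction `d`. -/
noncomputable def sliderRow (v : V) (d : Direction) : (V → Plane) →ₗ[ℝ] ℝ :=
  (innerSL ℝ (dirNormal d)).toLinearMap ∘ₗ (LinearMap.proj v : (V → Plane) →ₗ[ℝ] Plane)

lemma sliderRow_apply (v : V) (d : Direction) (m : V → Plane) :
    sliderRow v d m = inner ℝ (dirNormal d) (m v) := rfl

namespace BarJointSliderFramework

lemma isInfinitesimalMotion_iff (Φ : BarJointSliderFramework V E R) (m : V → Plane) :
    Φ.IsInfinitesimalMotion m ↔ (∀ e, barRow Φ.pos (Φ.ends e) m = 0) ∧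
      ∀ r, sliderRow (Φ.root r) (Φ.dir r) m = 0 := by
  unfold IsInfinitesimalMotion
  refine and_congr ⟨fun h e => ?_, fun h e u v he => ?_⟩ (forall_congr' fun r => ?_)
  · induction hz : Φ.ends e with | _ u w
    exact h e u w hz
  · rw [← barRow_mk, ← he]
    exact h e
  · rw [forall_unit_normal_iff, sliderRow_apply, real_inner_comm]

/-- A rigid framework has at least `2|V|` bars and sliders. -/
lemma IsInfinitesimallyRigid.card_le [Finite V] [Finite E] [Finite R]
    {Φ : BarJointSliderFramework V E R} (h : Φ.IsInfinitesimallyRigid) :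
    2 * Nat.card V ≤ Nat.card E + Nat.card R := by
  have := Fintype.ofFinite V
  have := Fintype.ofFinite E
  have := Fintype.ofFinite R
  let L : (V → Plane) →ₗ[ℝ] ((E → ℝ) × (R → ℝ)) :=
    (LinearMap.pi fun e => barRow Φ.pos (Φ.ends e)).prod
      (LinearMap.pi fun r => sliderRow (Φ.root r) (Φ.dir r))
  have hL : Function.Injective L := by
    rw [injective_iff_map_eq_zero]
    intro m hm
    refine h m ((Φ.isInfinitesimalMotion_iff m).2 ⟨fun e => ?_, fun r => ?_⟩)
    · exact congrFun (congrArg Prod.fst hm) e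
    · exact congrFun (congrArg Prod.snd hm) r
  have := LinearMap.finrank_le_finrank_of_injective hL
  rw [Module.finrank_prod, Module.finrank_fintype_fun_eq_card, Module.finrank_fintype_fun_eq_card,
    Module.finrank_pi_fintype] at this
  simp only [finrank_euclideanSpace_fin, Finset.sum_const, Finset.card_univ, smul_eq_mul] at this
  simp only [Nat.card_eq_fintype_card]
  omega

/-- Removing any constraint leaves fewer than the 2|V| that rigidity requires. -/
lemma isMinimallyInfinitesimallyRigid_of_card [Finite V] [Finite E] [Finite R]
    {Φ : BarJointSliderFramework V E R} (h : Φ.IsInfinitesimallyRigid)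
    (hc : Nat.card E + Nat.card R = 2 * Nat.card V) : Φ.IsMinimallyInfinitesimallyRigid := by
  classical
  have := Fintype.ofFinite V
  have := Fintype.ofFinite E
  have := Fintype.ofFinite R
  refine ⟨h, fun e he => ?_, fun r hr => ?_⟩
  · have h1 := he.card_le
    have h2 : Nat.card {e' : E // e' ≠ e} = Nat.card E - 1 := by
      simp [Nat.card_eq_fintype_card, Fintype.card_subtype_compl]
    have h3 : 0 < Nat.card E := Nat.card_pos_iff.2 ⟨⟨e⟩, inferInstance⟩
    omega
  · have h1 := hr.card_le
    have h2 : Nat.card {r' : R // r' ≠ r} = Nat.card R - 1 := by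
      simp [Nat.card_eq_fintype_card, Fintype.card_subtype_compl]
    have h3 : 0 < Nat.card R := Nat.card_pos_iff.2 ⟨⟨r⟩, inferInstance⟩
    omega

lemma IsMinimallyInfinitesimallyRigid.exists_bar {Φ : BarJointSliderFramework V E R}
    (h : Φ.IsMinimallyInfinitesimallyRigid) (e : E) :
    ∃ m, barRow Φ.pos (Φ.ends e) m ≠ 0 ∧ (∀ e' ≠ e, barRow Φ.pos (Φ.ends e') m = 0) ∧
      ∀ r, sliderRow (Φ.root r) (Φ.dir r) m = 0 := by
  have h1 := h.2.1 e
  unfold IsInfinitesimallyRigid at h1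
  push Not at h1
  obtain ⟨m, hm, hne⟩ := h1
  rw [isInfinitesimalMotion_iff] at hm
  refine ⟨m, fun h0 => hne (h.1 m ((Φ.isInfinitesimalMotion_iff m).2 ⟨fun e' => ?_, hm.2⟩)),
    fun e' he' => hm.1 ⟨e', he'⟩, hm.2⟩
  by_cases he' : e' = e
  · rw [he', h0]
  · exact hm.1 ⟨e', he'⟩

lemma IsMinimallyInfinitesimallyRigid.exists_slider {Φ : BarJointSliderFramework V E R}
    (h : Φ.IsMinimallyInfinitesimallyRigid) (r : R) :
    ∃ m, sliderRow (Φ.root r) (Φ.dir r) m ≠ 0 ∧ (∀ e, barRow Φ.pos (Φ.ends e) m = 0) ∧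
      ∀ r' ≠ r, sliderRow (Φ.root r') (Φ.dir r') m = 0 := by
  have h1 := h.2.2 r
  unfold IsInfinitesimallyRigid at h1
  push Not at h1
  obtain ⟨m, hm, hne⟩ := h1
  rw [isInfinitesimalMotion_iff] at hm
  refine ⟨m, fun h0 => hne (h.1 m ((Φ.isInfinitesimalMotion_iff m).2 ⟨hm.1, fun r' => ?_⟩)),
    hm.1, fun r' hr' => hm.2 ⟨r', hr'⟩⟩
  by_cases hr' : r' = r
  · rw [hr', h0]
  · exact hm.2 ⟨r', hr'⟩

end BarJointSliderFramework

/-- The vectors provided by `hf` are dual to the coordinates up to scaling, so `f` is onto; its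
kernel contains a copy of `K`, and rank-nullity concludes. -/
lemma card_add_finrank_le {ι A K : Type*} [Fintype ι] [AddCommGroup A] [Module ℝ A]
    [FiniteDimensional ℝ A] [AddCommGroup K] [Module ℝ K] (f : A →ₗ[ℝ] ι → ℝ)
    (hf : ∀ i, ∃ a, f a i ≠ 0 ∧ ∀ j ≠ i, f a j = 0) (g : K →ₗ[ℝ] A)
    (hg : Function.Injective g) (hfg : ∀ k, f (g k) = 0) :
    Fintype.card ι + Module.finrank ℝ K ≤ Module.finrank ℝ A := by
  classical
  have hsurj : LinearMap.range f = ⊤ := by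
    rw [eq_top_iff, ← (Pi.basisFun ℝ ι).span_eq, Submodule.span_le]
    rintro _ ⟨i, rfl⟩
    obtain ⟨a, hi, hj⟩ := hf i
    refine ⟨(f a i)⁻¹ • a, funext fun j => ?_⟩
    rw [map_smul, Pi.smul_apply, smul_eq_mul, Pi.basisFun_apply]
    by_cases hji : j = i
    · subst hji
      rw [inv_mul_cancel₀ hi, Pi.single_eq_same]
    · rw [hj j hji, mul_zero, Pi.single_eq_of_ne hji]
  have h1 := f.finrank_range_add_finrank_ker
  rw [hsurj, finrank_top, Module.finrank_fintype_fun_eq_card] at h1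
  have h2 := LinearMap.finrank_le_finrank_of_injective
    (f := g.codRestrict (LinearMap.ker f) fun k => LinearMap.mem_ker.2 (hfg k))
    (fun a b hab => hg (congrArg Subtype.val hab))
  omega

namespace BarJointSliderFramework

/-- The rows of bars and sliders on a vertex set `W` are independent and vanish on any given space
of motions of `W`. -/
lemma IsMinimallyInfinitesimallyRigid.ncard_add_finrank_le [Finite V] [Finite E] [Finite R]
    {Φ : BarJointSliderFramework V E R} (h : Φ.IsMinimallyInfinitesimallyRigid)
    (F : Set E) (Q : Set R) (W : Set V) (hF : ∀ e ∈ F, ∀ a ∈ Φ.ends e, a ∈ W)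
    (hQ : ∀ r ∈ Q, Φ.root r ∈ W) {K : Type*} [AddCommGroup K] [Module ℝ K]
    (g : K →ₗ[ℝ] V → Plane) (hg : ∀ k, (∀ v ∈ W, g k v = 0) → k = 0)
    (hgF : ∀ k, ∀ e ∈ F, barRow Φ.pos (Φ.ends e) (g k) = 0)
    (hgQ : ∀ k, ∀ r ∈ Q, sliderRow (Φ.root r) (Φ.dir r) (g k) = 0) :
    F.ncard + Q.ncard + Module.finrank ℝ K ≤ 2 * W.ncard := by
  classical
  have := Fintype.ofFinite V
  have := Fintype.ofFinite E
  have := Fintype.ofFinite R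
  -- Extension by zero: the chosen rows only see velocities on `W`, so they descend to this smaller
  -- space.
  let ext : (W → Plane) →ₗ[ℝ] V → Plane := LinearMap.pi fun v =>
    if hv : v ∈ W then LinearMap.proj ⟨v, hv⟩ else 0
  have hext : ∀ (m : V → Plane) (v : V), v ∈ W → ext (fun w => m w) v = m v := by
    intro m v hv
    simp [ext, hv]
  let f : (W → Plane) →ₗ[ℝ] (F ⊕ Q → ℝ) := LinearMap.pi fun i =>
    (Sum.elim (fun e : F => barRow Φ.pos (Φ.ends e))
      (fun r : Q => sliderRow (Φ.root r) (Φ.dir r)) i) ∘ₗ ext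
  have hfl : ∀ (m : V → Plane) (e : F),
      f (fun w => m w) (Sum.inl e) = barRow Φ.pos (Φ.ends e) m := fun m e =>
    barRow_congr _ _ fun a ha => hext m a (hF e e.2 a ha)
  have hfr : ∀ (m : V → Plane) (r : Q),
      f (fun w => m w) (Sum.inr r) = sliderRow (Φ.root r) (Φ.dir r) m := fun m r => by
    rw [sliderRow_apply, ← hext m _ (hQ r r.2)]
    rfl
  have hcard := card_add_finrank_le f (fun i => ?_)
    (LinearMap.pi fun w : W => LinearMap.proj (w : V) ∘ₗ g) ?_ (fun k => funext fun i => ?_)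
  · rw [Module.finrank_pi_fintype, Fintype.card_sum] at hcard
    simp only [finrank_euclideanSpace_fin, Finset.sum_const, Finset.card_univ,
      smul_eq_mul] at hcard
    simp only [← Nat.card_eq_fintype_card, Nat.card_coe_set_eq] at hcard
    omega
  · rcases i with e | r
    · obtain ⟨m, h1, h2, h3⟩ := h.exists_bar e
      refine ⟨fun w => m w, by rwa [hfl], fun j hj => ?_⟩
      rcases j with e' | r'
      · rw [hfl]
        exact h2 _ fun hh => hj (by rw [Subtype.ext hh])
      · rw [hfr, h3]
    · obtain ⟨m, h1, h2, h3⟩ := h.exists_slider r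
      refine ⟨fun w => m w, by rwa [hfr], fun j hj => ?_⟩
      rcases j with e' | r'
      · rw [hfl, h2]
      · rw [hfr]
        exact h3 _ fun hh => hj (by rw [Subtype.ext hh])
  · rw [injective_iff_map_eq_zero]
    intro k hk
    exact hg k fun v hv => congrFun hk ⟨v, hv⟩
  · rcases i with e | r
    · exact (hfl (g k) e).trans (hgF k e e.2)
    · exact (hfr (g k) r).trans (hgQ k r r.2)

variable [Finite V] [Finite E] [Finite R] {Φ : BarJointSliderFramework V E R}

lemma IsMinimallyInfinitesimallyRigid.ncard_add_ncard_le
    (h : Φ.IsMinimallyInfinitesimallyRigid) (F : Set E) (Q : Set R) (W : Set V)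
    (hF : ∀ e ∈ F, ∀ a ∈ Φ.ends e, a ∈ W) (hQ : ∀ r ∈ Q, Φ.root r ∈ W) :
    F.ncard + Q.ncard ≤ 2 * W.ncard := by
  have := h.ncard_add_finrank_le F Q W hF hQ (K := Fin 0 → ℝ) 0
    (fun k _ => Subsingleton.elim _ _) (fun k e _ => by simp) (fun k r _ => by simp)
  omega

lemma IsMinimallyInfinitesimallyRigid.card_eq (h : Φ.IsMinimallyInfinitesimallyRigid) :
    Nat.card E + Nat.card R = 2 * Nat.card V := by
  have h1 := h.ncard_add_ncard_le Set.univ Set.univ Set.univ (by simp) (by simp)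
  have h2 := h.1.card_le
  simp only [Set.ncard_univ] at h1
  omega

lemma IsMinimallyInfinitesimallyRigid.slidersAt (h : Φ.IsMinimallyInfinitesimallyRigid) (v : V) :
    (slidersAt Φ.root v).ncard ≤ 2 ∧ Set.InjOn Φ.dir (slidersAt Φ.root v) := by
  constructor
  · have := h.ncard_add_ncard_le ∅ (_root_.slidersAt Φ.root v) {v} (by simp) (fun r hr => hr)
    simpa using this
  · intro r hr r' hr' hd
    by_contra hne
    obtain ⟨m, h1, -, h3⟩ := h.exists_slider r
    apply h1
    have hr1 : Φ.root r = v := hr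
    have hr2 : Φ.root r' = v := hr'
    rw [hd, hr1, ← hr2]
    exact h3 r' (Ne.symm hne)

lemma IsMinimallyInfinitesimallyRigid.laman_count (h : Φ.IsMinimallyInfinitesimallyRigid)
    {F : Set E} (hF : F.Nonempty) :
    F.ncard + 3 ≤ 2 * (spannedVertices Φ.ends F).ncard := by
  obtain ⟨e, he⟩ := hF
  obtain ⟨a, b, hab⟩ : ∃ a b, Φ.ends e = s(a, b) := by
    induction hz : Φ.ends e with | _ u w
    exact ⟨u, w, rfl⟩
  have ha : a ∈ spannedVertices Φ.ends F := ⟨e, he, by rw [hab]; exact Sym2.mem_mk_left _ _⟩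
  have hb : b ∈ spannedVertices Φ.ends F := ⟨e, he, by rw [hab]; exact Sym2.mem_mk_right _ _⟩
  have hne : a ≠ b := by
    rintro rfl
    obtain ⟨m, h1, -⟩ := h.exists_bar e
    apply h1
    rw [hab, barRow_mk, sub_self, inner_zero_left]
  have hp : Φ.pos a - Φ.pos b ≠ 0 := sub_ne_zero.2 (Φ.pos_injective.ne hne)
  let rotL : Plane →ₗ[ℝ] Plane :=
    { toFun := rot
      map_add' := fun x y => plane_ext (by simp; ring) (by simp)
      map_smul' := fun c x => plane_ext (by simp) (by simp) }
  have hrot : ∀ x, rotL x = rot x := fun _ => rfl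
  -- Translations and infinitesimal rotations, a space of dimension 3. It acts faithfully because
  -- `F` spans two distinct points.
  let g : (Plane × ℝ) →ₗ[ℝ] V → Plane := LinearMap.pi fun v =>
    LinearMap.fst ℝ Plane ℝ + (LinearMap.snd ℝ Plane ℝ).smulRight (rot (Φ.pos v))
  have hg : ∀ k v, g k v = k.1 + k.2 • rot (Φ.pos v) := fun _ _ => rfl
  have := h.ncard_add_finrank_le F ∅ (spannedVertices Φ.ends F)
    (fun e he a ha => ⟨e, he, ha⟩) (by simp) g ?_ ?_ (by simp)
  · rw [Module.finrank_prod, finrank_euclideanSpace_fin, Module.finrank_self,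
      Set.ncard_empty] at this
    omega
  · intro k hk
    have h1 := hk a ha
    have h2 := hk b hb
    rw [hg] at h1 h2
    have h3 : k.2 • rot (Φ.pos a - Φ.pos b) = 0 := by
      rw [← hrot, map_sub, hrot, hrot, smul_sub, ← sub_eq_zero.2 (h1.trans h2.symm)]
      abel
    have h4 := (smul_eq_zero.1 h3).resolve_right (rot_ne_zero hp)
    rw [h4, zero_smul, add_zero] at h1
    exact Prod.ext h1 h4
  · intro k e _
    induction Φ.ends e with | _ u w
    rw [barRow_mk, hg, hg, add_sub_add_left_eq_sub, ← smul_sub, ← hrot, ← hrot, ← map_sub,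
      inner_smul_right, hrot, inner_plane]
    simp
    right
    ring

lemma IsMinimallyInfinitesimallyRigid.slider_count (h : Φ.IsMinimallyInfinitesimallyRigid)
    {F : Set E} (hF : F.Nonempty) :
    F.ncard + (slidersOn Φ.ends Φ.root F).ncard + 2 ≤
      2 * (spannedVertices Φ.ends F).ncard +
        min 2 (numDirections Φ.dir (slidersOn Φ.ends Φ.root F)) := by
  obtain ⟨a, ha⟩ : (spannedVertices Φ.ends F).Nonempty := by
    obtain ⟨e, he⟩ := hF
    exact ⟨(Φ.ends e).out.1, e, he, Sym2.out_fst_mem _⟩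
  set Q := slidersOn Φ.ends Φ.root F with hQ
  -- Translations by vectors in `T` respect all bars, and respect the sliders since `T` lies in each
  -- slider direction. The best `T` is the plane, a line or zero, for no, one or several directions.
  have key : ∀ T : Submodule ℝ Plane, (∀ r ∈ Q, T ≤ (Φ.dir r).submodule) →
      F.ncard + Q.ncard + Module.finrank ℝ T ≤ 2 * (spannedVertices Φ.ends F).ncard := by
    intro T hT
    refine h.ncard_add_finrank_le F Q (spannedVertices Φ.ends F)
      (fun e he a ha => ⟨e, he, ha⟩) (fun r hr => hr) (LinearMap.pi fun _ => T.subtype) ?_ ?_ ?_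
    · intro k hk
      exact Subtype.ext (hk a ha)
    · intro k e _
      induction Φ.ends e with | _ u w
      rw [barRow_mk]
      simp
    · intro k r hr
      rw [sliderRow_apply, real_inner_comm]
      exact (mem_submodule_iff _ _).1 (hT r hr k.2)
  have hc : numDirections Φ.dir Q = 0 ∨ numDirections Φ.dir Q = 1 ∨
      2 ≤ numDirections Φ.dir Q := by omega
  rcases hc with hc | hc | hc
  · have hQe : Q = ∅ := by
      have := (Set.ncard_eq_zero (Set.toFinite _)).1 hc
      exact Set.image_eq_empty.1 this
    have := key ⊤ (by simp [hQe])
    rw [finrank_top, finrank_euclideanSpace_fin] at this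
    omega
  · obtain ⟨d, hd⟩ := Set.ncard_eq_one.1 hc
    have := key d.submodule fun r hr => by
      have : Φ.dir r ∈ ({d} : Set Direction) := hd ▸ Set.mem_image_of_mem _ hr
      rw [Set.mem_singleton_iff.1 this]
    rw [Projectivization.finrank_submodule] at this
    omega
  · have := key ⊥ (by simp)
    omega

end BarJointSliderFramework

end Rows

/-! ### From edge-set conditions to vertex-set conditions -/

section Transfer

variable {V E R : Type*} [DecidableEq V] [DecidableEq Direction] [Fintype V] [Fintype E] [Fintype R]

/-- The set of edges of a graph whose edges are given by their end-vertices. -/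
def edgeImage (ends : E → Sym2 V) : Finset (Sym2 V) := Finset.univ.image ends

/-- The sliders, as pairs of a vertex and a direction. -/
def sliderImage (root : R → V) (dir : R → Direction) : Finset (V × Direction) :=
  Finset.univ.image fun r => (root r, dir r)

lemma edgeCount_edgeImage {ends : E → Sym2 V} (h : Function.Injective ends) (Y : Finset V) :
    edgeCount (edgeImage ends) Y = {e | ∀ a ∈ ends e, a ∈ Y}.ncard := by
  classical
  unfold edgeCount edgeImage
  rw [Finset.filter_image, Finset.card_image_of_injective _ h, Set.ncard_eq_toFinset_card']
  congr 1
  ext e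
  simp [Finset.subset_iff]

lemma sliderCount_sliderImage {root : R → V} {dir : R → Direction}
    (h : Function.Injective fun r => (root r, dir r)) (Y : Finset V) :
    sliderCount (sliderImage root dir) Y = {r | root r ∈ Y}.ncard := by
  classical
  unfold sliderCount sliderImage
  rw [Finset.filter_image, Finset.card_image_of_injective _ h, Set.ncard_eq_toFinset_card']
  congr 1
  ext r
  simp

lemma card_sliderDirs_sliderImage (root : R → V) (dir : R → Direction) (Y : Finset V) :
    (sliderDirs (sliderImage root dir) Y).card = numDirections dir {r | root r ∈ Y} := by
  unfold numDirections
  rw [← Set.ncard_coe_finset]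
  congr 1
  ext d
  simp only [sliderDirs, sliderImage, Finset.coe_image, Set.mem_image, Finset.mem_coe,
    Finset.mem_filter, Finset.mem_image, Finset.mem_univ, true_and, Set.mem_ofPred_eq]
  constructor
  · rintro ⟨_, ⟨⟨r, rfl⟩, hr⟩, rfl⟩
    exact ⟨r, hr, rfl⟩
  · rintro ⟨r, hr, rfl⟩
    exact ⟨_, ⟨⟨r, rfl⟩, hr⟩, rfl⟩

lemma sliderCount_le_two_mul {α : Type*} [DecidableEq α] {S : Finset (V × α)}
    (h : ∀ v, sliderCount S {v} ≤ 2) (Y : Finset V) : sliderCount S Y ≤ 2 * Y.card := by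
  induction Y using Finset.induction_on with
  | empty => simp [sliderCount]
  | insert v Y hv ih =>
    rw [sliderCount_insert S hv, Finset.card_insert_of_notMem hv]
    have := h v
    omega

theorem sliderTight_of_count (ends : E → Sym2 V) (root : R → V) (dir : R → Direction)
    (h1 : ∀ v : V, (slidersAt root v).ncard ≤ 2 ∧ Set.InjOn dir (slidersAt root v))
    (h2 : ∀ F : Set E, F.Nonempty →
      F.ncard + (slidersOn ends root F).ncard + 2 ≤
        2 * (spannedVertices ends F).ncard + min 2 (numDirections dir (slidersOn ends root F)))
    (h3 : ∀ F : Set E, F.Nonempty → F.ncard + 3 ≤ 2 * (spannedVertices ends F).ncard)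
    (h4 : Nat.card E + Nat.card R = 2 * Nat.card V) :
    SliderTight Finset.univ (edgeImage ends) (sliderImage root dir) := by
  -- Parallel edges would violate the Laman count on at most two vertices, so passing to a set of
  -- edges loses no multiplicity.
  have hE : Function.Injective ends := by
    intro e e' he
    by_contra hne
    have h := h3 {e, e'} (Set.insert_nonempty _ _)
    rw [Set.ncard_pair hne] at h
    have hs : spannedVertices ends {e, e'} ⊆ ((ends e).toFinset : Set V) := by
      rintro v ⟨f, hf, hv⟩
      rw [Finset.mem_coe, Sym2.mem_toFinset]
      rcases hf with rfl | rfl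
      · exact hv
      · rwa [he]
    have h5 := Set.ncard_le_ncard hs
    rw [Set.ncard_coe_finset, Sym2.card_toFinset] at h5
    split_ifs at h5 <;> omega
  have hR : Function.Injective fun r => (root r, dir r) := by
    intro r r' hr
    obtain ⟨hr1, hr2⟩ := Prod.mk.inj hr
    exact (h1 (root r')).2 hr1 rfl hr2
  have hsub : ∀ Y : Finset V, spannedVertices ends {e | ∀ a ∈ ends e, a ∈ Y} ⊆ (Y : Set V) := by
    rintro Y v ⟨e, he, hv⟩
    exact he v hv
  have hone : ∀ v, sliderCount (sliderImage root dir) {v} ≤ 2 ∧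
      (sliderDirs (sliderImage root dir) {v}).card = sliderCount (sliderImage root dir) {v} := by
    intro v
    have hv : {r | root r ∈ ({v} : Finset V)} = slidersAt root v := by
      ext r; simp [slidersAt]
    rw [card_sliderDirs_sliderImage, sliderCount_sliderImage hR, hv]
    exact ⟨(h1 v).1, (h1 v).2.ncard_image⟩
  refine ⟨by simp, by simp, fun Y _ hY => ?_, fun Y _ hY => ?_, ?_⟩
  · rcases Set.eq_empty_or_nonempty {e | ∀ a ∈ ends e, a ∈ Y} with hF | hF
    -- Without induced edges the edge-set condition is silent. At one vertex `y` the sliders are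
    -- matched by their rank, and every other vertex has at most two.
    · obtain ⟨y, hy⟩ := hY
      rw [edgeCount_edgeImage hE, hF, Set.ncard_empty]
      have e1 := sliderCount_insert (sliderImage root dir) (Finset.notMem_erase y Y)
      rw [Finset.insert_erase hy] at e1
      have e2 := sliderCount_le_two_mul (fun v => (hone v).1) (Y.erase y)
      have e3 := Finset.card_erase_add_one hy
      have e4 : dirRank (sliderDirs (sliderImage root dir) {y}) ≤
          dirRank (sliderDirs (sliderImage root dir) Y) :=
        dirRank_mono (sliderDirs_mono _ (Finset.singleton_subset_iff.2 hy))
      have e5 : dirRank (sliderDirs (sliderImage root dir) {y}) =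
          sliderCount (sliderImage root dir) {y} := by
        have := hone y
        unfold dirRank
        omega
      omega
    · have e1 := h2 _ hF
      -- The edge-set condition controls only the vertices `W` met by induced edges; each vertex of
      -- `Y \ W` adds at most two sliders and exactly 2 to the bound.
      obtain ⟨W, hW⟩ : ∃ W : Finset V,
          (W : Set V) = spannedVertices ends {e | ∀ a ∈ ends e, a ∈ Y} :=
        (Set.toFinite _).exists_finset_coe
      have hQ : slidersOn ends root {e | ∀ a ∈ ends e, a ∈ Y} = {r | root r ∈ W} := by
        ext r
        simp only [slidersOn, Set.mem_ofPred_eq]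
        rw [← hW, Finset.mem_coe]
      have hWY : W ⊆ Y := by
        rw [← Finset.coe_subset, hW]
        exact hsub Y
      rw [hQ, ← hW, Set.ncard_coe_finset, ← edgeCount_edgeImage hE,
        ← sliderCount_sliderImage hR, ← card_sliderDirs_sliderImage] at e1
      have e2 := sliderCount_union (sliderImage root dir) W (Y \ W)
      rw [Finset.union_sdiff_of_subset hWY, Finset.inter_sdiff_self] at e2
      have e3 := sliderCount_le_two_mul (fun v => (hone v).1) (Y \ W)
      have e4 := Finset.card_sdiff_add_card_eq_card hWY
      have e5 : dirRank (sliderDirs (sliderImage root dir) W) ≤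
          dirRank (sliderDirs (sliderImage root dir) Y) :=
        dirRank_mono (sliderDirs_mono _ hWY)
      have e6 : dirRank (sliderDirs (sliderImage root dir) W) =
        min 2 (sliderDirs (sliderImage root dir) W).card := rfl
      omega
  · rcases Set.eq_empty_or_nonempty {e | ∀ a ∈ ends e, a ∈ Y} with hF | hF
    · rw [edgeCount_edgeImage hE, hF, Set.ncard_empty]
      omega
    · have e1 := h3 _ hF
      have e2 := Set.ncard_le_ncard (hsub Y)
      rw [Set.ncard_coe_finset] at e2
      rw [edgeCount_edgeImage hE]
      omega
  · unfold edgeImage sliderImage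
    rw [Finset.card_image_of_injective _ hE, Finset.card_image_of_injective _ hR]
    simpa only [Finset.card_univ, ← Nat.card_eq_fintype_card] using h4

lemma IsRigidOn.isInfinitesimallyRigid {ends : E → Sym2 V} {root : R → V} {dir : R → Direction}
    {p : V → Plane} (h : IsRigidOn Finset.univ (edgeImage ends) (sliderImage root dir) p)
    (hp : Function.Injective p) :
    (BarJointSliderFramework.mk ends root dir p hp).IsInfinitesimallyRigid := by
  intro m hm
  obtain ⟨-, hs⟩ := (BarJointSliderFramework.isInfinitesimalMotion_iff _ m).1 hm
  refine h m (fun x hx => absurd (Finset.mem_univ x) hx) ⟨fun u w huw => ?_, fun r hr => ?_⟩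
  · obtain ⟨e, -, he⟩ := Finset.mem_image.1 huw
    exact hm.1 e u w he
  · obtain ⟨r, -, rfl⟩ := Finset.mem_image.1 hr
    exact hs r

end Transfer

theorem mainTheorem10 {V E R : Type*} [Finite V] [Finite E] [Finite R]
    (ends : E → Sym2 V) (root : R → V) (dir : R → Direction) :
    (∃ (p : V → Plane) (hp : Function.Injective p),
      (BarJointSliderFramework.mk ends root dir p hp).IsMinimallyInfinitesimallyRigid) ↔
    ((∀ v : V, (slidersAt root v).ncard ≤ 2 ∧ Set.InjOn dir (slidersAt root v)) ∧
      (∀ F : Set E, F.Nonempty →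
        (F.ncard : ℤ) + (slidersOn ends root F).ncard ≤
          2 * (spannedVertices ends F).ncard - 2
            + min 2 (numDirections dir (slidersOn ends root F) : ℤ)) ∧
      (∀ F : Set E, F.Nonempty →
        (F.ncard : ℤ) ≤ 2 * (spannedVertices ends F).ncard - 3) ∧
      Nat.card E + Nat.card R = 2 * Nat.card V) := by
  classical
  have := Fintype.ofFinite V
  have := Fintype.ofFinite E
  have := Fintype.ofFinite R
  constructor
  · rintro ⟨p, hp, h⟩
    refine ⟨h.slidersAt, fun F hF => ?_, fun F hF => ?_, h.card_eq⟩
    · have := h.slider_count hF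
      dsimp only at this
      omega
    · have := h.laman_count hF
      dsimp only at this
      omega
  · rintro ⟨h1, h2, h3, h4⟩
    have hT := sliderTight_of_count ends root dir h1
      (fun F hF => by have := h2 F hF; omega) (fun F hF => by have := h3 F hF; omega) h4
    obtain ⟨p, hp⟩ := hT.exists_isRigidOn
    -- The inductive construction may make joints coincide; a small perturbation separates them and
    -- preserves rigidity.
    obtain ⟨p, hp, hinj⟩ := hp.exists_injective
    exact ⟨p, hinj, BarJointSliderFramework.isMinimallyInfinitesimallyRigid_of_card
      (hp.isInfinitesimallyRigid hinj) h4⟩
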